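/- Let $n\ge 1$, let $F=F(x,y,w,q)$ be a $C^\infty$ real-valued function on $\mathbb R\times\mathbb R^{n-1}\times\mathbb R\times\mathbb R^{n-1}$, and let $\omega_0$ be a $C^\infty$ real-valued function on $\mathbb R^{n-1}$. Consider the singular initial value problem $$x\,\partial_x\omega=F(x,y,\omega,\partial_y\omega),\qquad \omega(0,y)=\omega_0(y), \tag{$*$}$$ for a real-valued function $\omega(x,y)$, where $x\ge 0$, $y\in\mathbb R^{n-1}$ and $\partial_y\omega=(\partial_{y_1}\omega,\dots,\partial_{y_{n-1}}\omega)$. Suppose that for all $y\in\mathbb R^{n-1}$ $$F(0,y,\omega_0(y),\partial_y\omega_0(y))=0,\qquad F_q(0,y,\omega_0(y),\partial_y\omega_0(y))=0,\qquad F_w(0,y,\omega_0(y),\partial_y\omega_0(y))<1 .$$ Then $(*)$ has a unique smooth solution for sufficiently small $x\ge 0$, in the following sense. Call $U$ a boundary neighbourhood if it is a relatively open subset of $[0,\infty)\times\mathbb R^{n-1}$ containing $\{0\}\times\mathbb R^{n-1}$. 1. (Existence) There are a boundary neighbourhood $U$ and a function $\omega$ on $U$, $C^\infty$ up to and including $x=0$,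 that satisfies $(*)$ on $U$. 2. (Uniqueness) If $\omega_1$ and $\omega_2$ are such solutions on boundary neighbourhoods $U_1$ and $U_2$, then $\omega_1=\omega_2$ on some boundary neighbourhood $V\subseteq U_1\cap U_2$. -/

import Mathlib

/-- `U` is a neighbourhood of the whole boundary `{x = 0}` in the closed half-space
`{(x, y) : 0 ≤ x}`, and is relatively open there. The width of `U` in the `x` direction may
depend on `y`. -/
def IsBoundaryNhd {m : ℕ} (U : Set (ℝ × EuclideanSpace ℝ (Fin m))) : Prop :=
  (∃ O : Set (ℝ × EuclideanSpace ℝ (Fin m)), IsOpen O ∧ U = O ∩ {p | 0 ≤ p.1}) ∧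
    ∀ y : EuclideanSpace ℝ (Fin m), ((0 : ℝ), y) ∈ U

/-- `ω` is a smooth (up to and including the boundary `x = 0`) solution on `U` of
`x ∂ₓω = F(x, y, ω, ∂_yω)`, `ω(0, y) = ω₀(y)`. The `x`-derivative is one-sided at `x = 0`, and
`∂_yω` is the vector of partial derivatives in `y` with `x` fixed. -/
structure IsSmoothSolutionOn {m : ℕ}
    (F : ℝ × EuclideanSpace ℝ (Fin m) × ℝ × EuclideanSpace ℝ (Fin m) → ℝ)
    (ω₀ : EuclideanSpace ℝ (Fin m) → ℝ)
    (U : Set (ℝ × EuclideanSpace ℝ (Fin m)))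
    (ω : ℝ × EuclideanSpace ℝ (Fin m) → ℝ) : Prop where
  smooth : ContDiffOn ℝ ((⊤ : ℕ∞) : WithTop ℕ∞) ω U
  initial : ∀ y, ω (0, y) = ω₀ y
  eqn : ∀ x y, (x, y) ∈ U →
    x * derivWithin (fun s => ω (s, y)) (Set.Ici 0) x =
      F (x, y, ω (x, y), gradient (fun z => ω (x, z)) y)

/-!
The equation is of Fuchsian type and scalar, so it can be solved by characteristics.

*Existence.* At `x = 0` differentiating the equation forces `ω = ω₀ + x ψ₀ + o(x)` with
`ψ₀ = F_x / (1 - F_w)`. For `ω = ω₀ + x (ψ₀ + χ)`, Hadamard's lemma (`exists_smooth_eq_mul`) turns the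
equation into `x χₓ = -c χ + x G (x, y, χ, ∂_y χ)` with `c = 1 - F_w > 0` and `G` smooth
(`exists_local_solution`). Its characteristic system, written for `Y = η + x a`, `χ = x X`, `q = x Q`,
has the form `x z' + B z = h (x, η, z)` for `z = (a, X, Q)`, where `B` is diagonal with entries `≥ 1`,
and at the base point the linearisation of `h` in `z` has square zero. Such a system is the integral
equation `u = S (t ↦ h (t l, η, u t))` for `u t = z (t l)` on `[0, 1]`, where `S` inverts
`t d/dt + B`. Both `l` and `η` are now parameters, and the right-hand side is a smooth function of
`(l, η, u)` with `u` in a space of continuous functions (`contDiff_superposition`). The implicit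
function theorem therefore gives solutions that are smooth in `(x, η)` also across `x = 0`
(`exists_smooth_singular_solution`, `exists_smooth_characteristics`). The contact form `dχ - ⟨q, dY⟩`
solves a scalar equation `x r' = (-c + x G_w) r` with `r = 0` at `x = 0`, so it vanishes for `x ≥ 0`
(`contactForm_ode`, `eq_zero_of_singular_ode`); inverting `(x, η) ↦ (x, Y)` then gives a solution
near each boundary point (`exists_smooth_reduced_solution`).

*Uniqueness.* The difference `v` of two solutions is `O(x)` and satisfies
`x vₓ - ⟨b, v_y⟩ = a v` with `a ≤ s < 1` and `|b| ≤ C x`, because `F_w < 1` and `F_q = 0` on the initial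
jet. A maximum principle for `v / x ^ α`, `s < α < 1`, on a cone of dependence gives `v = 0` near each
boundary point (`eventually_nonpos_of_transport_inequality`, `eventually_eq_of_solutions`).

*Globalisation.* Local solutions agree near common boundary points, so they can be glued along a
locally finite cover of the boundary (`exists_glued_function`).
-/

namespace FuchsianPDE

open Set Filter Topology
open scoped ContDiff unitInterval

/-! ### Superposition operators and Hadamard's lemma -/

section Superposition

universe u
variable {K : Type*} [TopologicalSpace K] [CompactSpace K]

/-- Pointwise evaluation of a continuous family of operators on a continuous family of vectors,
as a bounded bilinear map. -/
noncomputable def pointwiseApply (K : Type*) [TopologicalSpace K] [CompactSpace K]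
    (E F : Type*) [NormedAddCommGroup E] [NormedSpace ℝ E] [NormedAddCommGroup F]
    [NormedSpace ℝ F] : C(K, E →L[ℝ] F) →L[ℝ] C(K, E) →L[ℝ] C(K, F) :=
  LinearMap.mkContinuous₂
    (LinearMap.mk₂ ℝ (fun (A : C(K, E →L[ℝ] F)) (v : C(K, E)) =>
        (⟨fun t => A t (v t), by fun_prop⟩ : C(K, F)))
      (fun A B v => by ext; simp) (fun r A v => by ext; simp)
      (fun A v w => by ext; simp) (fun r A v => by ext; simp)) 1
    (fun A v => by
      rw [one_mul]
      refine (ContinuousMap.norm_le _ (by positivity)).2 fun t => ?_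
      exact (A t).le_of_opNorm_le_of_le (A.norm_coe_le_norm t) (v.norm_coe_le_norm t))

@[simp] lemma pointwiseApply_apply {E F : Type*} [NormedAddCommGroup E] [NormedSpace ℝ E]
    [NormedAddCommGroup F] [NormedSpace ℝ F] (A : C(K, E →L[ℝ] F)) (v : C(K, E)) (t : K) :
    pointwiseApply K E F A v t = A t (v t) := rfl

lemma hasFDerivAt_superposition {E F : Type*} [NormedAddCommGroup E] [NormedSpace ℝ E]
    [NormedAddCommGroup F] [NormedSpace ℝ F] (f : C(E, F)) (f' : C(E, E →L[ℝ] F))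
    (hf : ∀ x, HasFDerivAt f (f' x) x) (u : C(K, E)) :
    HasFDerivAt (fun v : C(K, E) => f.comp v) (pointwiseApply K E F (f'.comp u)) u := by
  rw [hasFDerivAt_iff_isLittleO, Asymptotics.isLittleO_iff]
  intro ε hε
  have hc : Continuous fun w : C(K, E) => f'.comp w := ContinuousMap.continuous_postcomp f'
  have hev : ∀ᶠ w in 𝓝 u, dist (f'.comp w) (f'.comp u) < ε :=
    (hc.tendsto u).eventually (Metric.ball_mem_nhds (f'.comp u) hε)
  obtain ⟨δ, hδ, hball⟩ := Metric.eventually_nhds_iff_ball.1 hev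
  filter_upwards [Metric.ball_mem_nhds u hδ] with v hv
  refine (ContinuousMap.norm_le _ (by positivity)).2 fun t => ?_
  have key : ‖f (v t) - f (u t) - f' (u t) (v t - u t)‖ ≤ ε * ‖v t - u t‖ := by
    refine (convex_segment (𝕜 := ℝ) (u t) (v t)).norm_image_sub_le_of_norm_hasFDerivWithin_le'
      (fun z _ => (hf z).hasFDerivWithinAt) (fun z hz => ?_) (left_mem_segment ℝ _ _)
      (right_mem_segment ℝ _ _)
    obtain ⟨a, b, ha, hb, hab, rfl⟩ := hz
    have hw : a • u + b • v ∈ Metric.ball u δ :=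
      (convex_ball u δ) (Metric.mem_ball_self hδ) hv ha hb hab
    have h1 := (hball _ hw).le
    rw [← dist_eq_norm]
    exact (ContinuousMap.dist_apply_le_dist (f := f'.comp (a • u + b • v))
      (g := f'.comp u) t).trans h1
  refine le_trans key ?_
  gcongr
  exact (v - u).norm_coe_le_norm t

/-- The superposition operator `u ↦ f ∘ u` on continuous functions over a compact space is as
smooth as `f`. -/
theorem contDiff_superposition {E F : Type u} [NormedAddCommGroup E] [NormedSpace ℝ E]
    [NormedAddCommGroup F] [NormedSpace ℝ F] {n : ℕ∞} (f : C(E, F)) (hf : ContDiff ℝ n f) :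
    ContDiff ℝ n (fun v : C(K, E) => f.comp v) := by
  suffices H : ∀ (n : ℕ) (F : Type u) [NormedAddCommGroup F] [NormedSpace ℝ F] (f : C(E, F)),
      ContDiff ℝ n f → ContDiff ℝ n (fun v : C(K, E) => f.comp v) by
    refine contDiff_iff_forall_nat_le.2 fun m hm => H m F f (hf.of_le (by exact_mod_cast hm))
  intro n
  induction n with
  | zero =>
    intro F _ _ f _
    exact contDiff_zero.2 (ContinuousMap.continuous_postcomp f)
  | succ n ih =>
    intro F _ _ f hf
    have hf' := hf
    push_cast at hf' ⊢
    rw [contDiff_succ_iff_hasFDerivAt] at hf' ⊢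
    obtain ⟨f', hf'n, hf'⟩ := hf'
    refine ⟨fun u => pointwiseApply K E F ((⟨f', hf'n.continuous⟩ : C(E, E →L[ℝ] F)).comp u),
      ?_, fun u => ?_⟩
    · exact (pointwiseApply K E F).contDiff.comp
        (ih (E →L[ℝ] F) ⟨f', hf'n.continuous⟩ hf'n)
    · exact hasFDerivAt_superposition f ⟨f', hf'n.continuous⟩ hf' u

end Superposition

/-- **Hadamard's lemma** with parameters: a smooth function vanishing on `{x = 0}` is `x` times
a smooth function. -/
theorem exists_smooth_eq_mul {V : Type} [NormedAddCommGroup V] [NormedSpace ℝ V] {k : ℝ × V → ℝ}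
    (hk : ContDiff ℝ ∞ k) (h0 : ∀ v, k (0, v) = 0) :
    ∃ k₁ : ℝ × V → ℝ, ContDiff ℝ ∞ k₁ ∧ (∀ x v, k (x, v) = x * k₁ (x, v)) ∧
      ∀ v, k₁ (0, v) = fderiv ℝ k (0, v) (1, 0) := by
  have hd : ContDiff ℝ ∞ (fun p : ℝ × V => fderiv ℝ k p (1, 0)) :=
    (hk.fderiv_right (m := ∞) (by simp)).clm_apply contDiff_const
  -- the curve `s ↦ (s x, v)` as an element of `C([0, 1], ℝ × V)`, linear in `(x, v)`
  let c : C(I, ℝ × V →L[ℝ] ℝ × V) :=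
    ⟨fun s => (s : ℝ) • (ContinuousLinearMap.inl ℝ ℝ V).comp (ContinuousLinearMap.fst ℝ ℝ V) +
      (ContinuousLinearMap.inr ℝ ℝ V).comp (ContinuousLinearMap.snd ℝ ℝ V), by fun_prop⟩
  let cst : ℝ × V →L[ℝ] C(I, ℝ × V) := ContinuousLinearMap.const ℝ I
  let J : C(I, ℝ) →L[ℝ] ℝ := LinearMap.mkContinuous
    { toFun := fun u => ∫ s in (0:ℝ)..1, u (projIcc 0 1 zero_le_one s)
      map_add' := fun u v => by
        simp only [ContinuousMap.add_apply]
        refine intervalIntegral.integral_add ?_ ?_ <;>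
        exact (by fun_prop : Continuous _).intervalIntegrable _ _
      map_smul' := fun r u => by simp } 1 (fun u => by
        have := intervalIntegral.norm_integral_le_of_norm_le_const (a := 0) (b := 1) (C := ‖u‖)
          (f := fun s => u (projIcc (0:ℝ) 1 zero_le_one s)) (fun s _ => u.norm_coe_le_norm _)
        simpa using this)
  let k₁ : ℝ × V → ℝ := fun p =>
    J ((⟨_, hd.continuous⟩ : C(ℝ × V, ℝ)).comp (pointwiseApply I _ _ c (cst p)))
  have hk₁ : ∀ p, k₁ p = ∫ s in (0:ℝ)..1, fderiv ℝ k (s * p.1, p.2) (1, 0) := by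
    intro p
    refine intervalIntegral.integral_congr fun s hs => ?_
    rw [uIcc_of_le zero_le_one] at hs
    simp [c, cst, projIcc_of_mem zero_le_one hs]
  refine ⟨k₁, ?_, ?_, ?_⟩
  · refine J.contDiff.comp ((contDiff_superposition (n := ⊤) _ hd).comp ?_)
    exact (pointwiseApply I _ _ c).contDiff.comp cst.contDiff
  · intro x v
    rw [hk₁, ← intervalIntegral.integral_const_mul]
    have hder : ∀ s ∈ uIcc (0:ℝ) 1, HasDerivAt (fun s : ℝ => k (s * x, v))
        (x * fderiv ℝ k (s * x, v) (1, 0)) s := by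
      intro s _
      have h1 : HasDerivAt (fun s : ℝ => (s * x, v)) (x, 0) s := by
        simpa using ((hasDerivAt_id s).mul_const x).prodMk (hasDerivAt_const s v)
      have h2 := ((hk.differentiable (by simp)) (s * x, v)).hasFDerivAt.comp_hasDerivAt s h1
      rwa [show ((x, 0) : ℝ × V) = x • ((1 : ℝ), (0 : V)) by simp, map_smul,
        smul_eq_mul] at h2
    have hcont : Continuous fun s : ℝ => x * fderiv ℝ k (s * x, v) (1, 0) :=
      continuous_const.mul (hd.continuous.comp (by fun_prop : Continuous fun s : ℝ => (s * x, v)))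
    rw [intervalIntegral.integral_eq_sub_of_hasDerivAt hder (hcont.intervalIntegrable _ _)]
    simp [h0]
  · intro v
    simp [hk₁]

/-! ### Averaging operators on the unit interval -/

section Averaging

variable {V : Type*} [NormedAddCommGroup V] [NormedSpace ℝ V]

/-- Precomposition with the dilation `t ↦ s t` of the unit interval. -/
def dilate {V : Type*} [TopologicalSpace V] (s : I) (v : C(I, V)) : C(I, V) :=
  v.comp ⟨fun t => s * t, by fun_prop⟩

@[simp] lemma dilate_apply {V : Type*} [TopologicalSpace V] (s : I) (v : C(I, V)) (t : I) :
    dilate s v t = v (s * t) := rfl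

lemma norm_dilate_sub_const_le {V : Type*} [NormedAddCommGroup V] (s : I) (v : C(I, V)) (w : V) :
    ‖dilate s v - ContinuousMap.const I w‖ ≤ ‖v - ContinuousMap.const I w‖ :=
  (ContinuousMap.norm_le _ (norm_nonneg _)).2 fun t =>
    (v - ContinuousMap.const I w).norm_coe_le_norm (s * t)

lemma continuous_averaging_integrand {κ : ℝ} (hκ : 1 ≤ κ) (v : C(I, V)) :
    Continuous fun p : ℝ × ℝ => p.2 ^ (κ - 1) • v (projIcc 0 1 zero_le_one (p.1 * p.2)) := by
  have h := Real.continuous_rpow_const (q := κ - 1) (by linarith)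
  have h2 : Continuous fun p : ℝ × ℝ => projIcc (0:ℝ) 1 zero_le_one (p.1 * p.2) :=
    continuous_projIcc.comp (by fun_prop)
  exact (h.comp continuous_snd).smul (v.continuous.comp h2)

lemma averaging_integrable {κ : ℝ} (hκ : 1 ≤ κ) (v : C(I, V)) (t a b : ℝ) :
    IntervalIntegrable (fun s : ℝ => s ^ (κ - 1) • v (projIcc 0 1 zero_le_one (t * s)))
      MeasureTheory.volume a b :=
  ((continuous_averaging_integrand hκ v).comp
    (by fun_prop : Continuous fun s : ℝ => (t, s))).intervalIntegrable _ _

/-- The averaging operator `v ↦ (t ↦ ∫₀¹ s^(κ-1) v (t s) ds)` on `C([0, 1], V)`, for `κ ≥ 1`.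
It inverts the singular operator `v ↦ t v' + κ v`. -/
noncomputable def averaging (V : Type*) [NormedAddCommGroup V] [NormedSpace ℝ V] (κ : ℝ)
    (hκ : 1 ≤ κ) : C(I, V) →L[ℝ] C(I, V) :=
  LinearMap.mkContinuous
    { toFun := fun v =>
        ⟨fun t => ∫ s in (0:ℝ)..1, s ^ (κ - 1) • v (projIcc 0 1 zero_le_one (t * s)),
          (intervalIntegral.continuous_parametric_intervalIntegral_of_continuous'
            (f := fun (t s : ℝ) => s ^ (κ - 1) • v (projIcc 0 1 zero_le_one (t * s)))
            (continuous_averaging_integrand hκ v) 0 1).comp continuous_subtype_val⟩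
      map_add' := fun u v => by
        ext t
        simp only [ContinuousMap.coe_mk, ContinuousMap.add_apply, smul_add]
        exact intervalIntegral.integral_add (averaging_integrable hκ u _ _ _)
          (averaging_integrable hκ v _ _ _)
      map_smul' := fun r u => by
        ext t
        simp only [ContinuousMap.coe_mk, ContinuousMap.smul_apply, RingHom.id_apply,
          smul_comm _ r]
        exact intervalIntegral.integral_smul _ _ } 1 (fun v => by
    refine (ContinuousMap.norm_le _ (by positivity)).2 fun t => ?_
    have := intervalIntegral.norm_integral_le_of_norm_le_const (a := 0) (b := 1) (C := ‖v‖)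
      (f := fun s : ℝ => s ^ (κ - 1) • v (projIcc (0:ℝ) 1 zero_le_one (t * s))) (fun s hs => by
        rw [uIoc_of_le zero_le_one] at hs
        rw [norm_smul, Real.norm_of_nonneg (Real.rpow_nonneg hs.1.le _)]
        exact (mul_le_of_le_one_left (norm_nonneg _)
          (Real.rpow_le_one hs.1.le hs.2 (by linarith))).trans (v.norm_coe_le_norm _))
    simpa using this)

lemma averaging_apply {κ : ℝ} (hκ : 1 ≤ κ) (v : C(I, V)) (t : I) :
    averaging V κ hκ v t =
      ∫ s in (0:ℝ)..1, s ^ (κ - 1) • v (projIcc 0 1 zero_le_one (t * s)) := rfl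

lemma averaging_dilate {κ : ℝ} (hκ : 1 ≤ κ) (v : C(I, V)) (r : I) :
    averaging V κ hκ (dilate r v) = dilate r (averaging V κ hκ v) := by
  ext t
  rw [averaging_apply, dilate_apply, averaging_apply]
  refine intervalIntegral.integral_congr fun s hs => ?_
  rw [uIcc_of_le zero_le_one] at hs
  have h1 : (t : ℝ) * s ∈ Icc (0:ℝ) 1 := (t * ⟨s, hs⟩ : I).2
  have h2 : ((r * t : I) : ℝ) * s ∈ Icc (0:ℝ) 1 := (r * t * ⟨s, hs⟩ : I).2
  simp only [dilate_apply, projIcc_of_mem zero_le_one h1, projIcc_of_mem zero_le_one h2]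
  congr 2
  ext
  simp [mul_assoc]

variable [CompleteSpace V]

lemma averaging_const {κ : ℝ} (hκ : 1 ≤ κ) (w : V) :
    averaging V κ hκ (ContinuousMap.const I w) = ContinuousMap.const I (κ⁻¹ • w) := by
  ext t
  rw [averaging_apply]
  simp only [ContinuousMap.const_apply]
  rw [intervalIntegral.integral_smul_const, integral_rpow (Or.inl (by linarith))]
  rw [sub_add_cancel, Real.one_rpow, Real.zero_rpow (by linarith), sub_zero, one_div]

/-- `u = averaging v` solves the singular equation `t u' + κ u = v`. -/
theorem averaging_ode {κ : ℝ} (hκ : 1 ≤ κ) (v : C(I, V)) (t : I) (ht0 : 0 < (t : ℝ))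
    (ht1 : (t : ℝ) < 1) :
    ∃ d : V, HasDerivAt (fun r : ℝ => averaging V κ hκ v (projIcc 0 1 zero_le_one r)) d t ∧
      (t : ℝ) • d = v t - κ • averaging V κ hκ v t := by
  set g : ℝ → V := fun r => r ^ (κ - 1) • v (projIcc 0 1 zero_le_one r) with hg
  have hgc : Continuous g :=
    (Real.continuous_rpow_const (by linarith)).smul (v.continuous.comp continuous_projIcc)
  have hscale : ∀ r ∈ Ioo (0:ℝ) 1, averaging V κ hκ v (projIcc 0 1 zero_le_one r) =
      r ^ (-κ) • ∫ s in (0:ℝ)..r, g s := by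
    intro r hr
    have hr' : r ∈ Icc (0:ℝ) 1 := ⟨hr.1.le, hr.2.le⟩
    have h1 := intervalIntegral.integral_comp_mul_left (a := 0) (b := 1) g hr.1.ne'
    rw [mul_zero, mul_one] at h1
    have h2 : ∫ s in (0:ℝ)..1, g (r * s) =
        r ^ (κ - 1) • averaging V κ hκ v (projIcc 0 1 zero_le_one r) := by
      rw [averaging_apply, ← intervalIntegral.integral_smul]
      refine intervalIntegral.integral_congr fun s hs => ?_
      rw [uIcc_of_le zero_le_one] at hs
      simp only [hg, projIcc_of_mem zero_le_one hr', smul_smul, Real.mul_rpow hr.1.le hs.1]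
    rw [h2] at h1
    have h3 : ∫ s in (0:ℝ)..r, g s =
        r ^ κ • averaging V κ hκ v (projIcc 0 1 zero_le_one r) := by
      rw [← smul_inv_smul₀ hr.1.ne' (∫ s in (0:ℝ)..r, g s), ← h1, smul_smul]
      congr 1
      rw [Real.rpow_sub_one hr.1.ne']
      field_simp [hr.1.ne']
    rw [h3, smul_smul, ← Real.rpow_add hr.1]
    simp
  have hP : HasDerivAt (fun r : ℝ => ∫ s in (0:ℝ)..r, g s) (g t) t :=
    intervalIntegral.integral_hasDerivAt_right (hgc.intervalIntegrable _ _)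
      (hgc.stronglyMeasurableAtFilter _ _) hgc.continuousAt
  have hd := (Real.hasDerivAt_rpow_const (p := -κ) (Or.inl ht0.ne')).smul hP
  refine ⟨_, hd.congr_of_eventuallyEq ?_, ?_⟩
  · filter_upwards [Ioo_mem_nhds ht0 ht1] with r hr using hscale r hr
  · have hs := hscale t ⟨ht0, ht1⟩
    rw [projIcc_val] at hs
    have e1 : (t : ℝ) * (t : ℝ) ^ (-κ) * (t : ℝ) ^ (κ - 1) = 1 := by
      rw [Real.rpow_sub_one ht0.ne', Real.rpow_neg ht0.le]
      have := (Real.rpow_pos_of_pos ht0 κ).ne'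
      field_simp
    have e2 : (t : ℝ) * (-κ * (t : ℝ) ^ (-κ - 1)) = -κ * (t : ℝ) ^ (-κ) := by
      rw [Real.rpow_sub_one ht0.ne']
      field_simp
    rw [hs]
    simp only [hg, projIcc_val, smul_add, smul_smul]
    rw [← mul_assoc, e1, e2, one_smul, neg_mul, neg_smul]
    abel

end Averaging

/-! ### Singular integral equations with parameters -/

/-- Inverse function theorem for a map that is smooth near `a`: the local inverse is smooth on
its whole domain, and the derivative stays invertible there. -/
theorem exists_smooth_local_inverse {A B : Type*} [NormedAddCommGroup A] [NormedSpace ℝ A]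
    [CompleteSpace A] [NormedAddCommGroup B] [NormedSpace ℝ B] {f : A → B} {a : A} {U : Set A}
    (hU : IsOpen U) (ha : a ∈ U) (hf : ∀ x ∈ U, ContDiffAt ℝ ∞ f x) {f' : A ≃L[ℝ] B}
    (hf' : HasFDerivAt f (f' : A →L[ℝ] B) a) :
    ∃ e : OpenPartialHomeomorph A B, a ∈ e.source ∧ e.source ⊆ U ∧ (∀ x, e x = f x) ∧
      (∀ y ∈ e.target, ContDiffAt ℝ ∞ e.symm y) ∧
      ∀ x ∈ e.source, ∃ g : A ≃L[ℝ] B, HasFDerivAt f (g : A →L[ℝ] B) x := by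
  have hcont : ContinuousOn (fderiv ℝ f) U := fun x hx =>
    ((hf x hx).fderiv_right (m := 0) (by simp)).continuousAt.continuousWithinAt
  set O : Set A := U ∩ fderiv ℝ f ⁻¹' range ((↑) : (A ≃L[ℝ] B) → A →L[ℝ] B) with hO
  have hOo : IsOpen O := hcont.isOpen_inter_preimage hU ContinuousLinearEquiv.isOpen
  have haO : a ∈ O := ⟨ha, f', hf'.fderiv.symm⟩
  let e₀ := (hf a ha).toOpenPartialHomeomorph f hf' (by simp)
  have he₀ : ∀ x, e₀ x = f x := fun x => rfl
  let e := e₀.restrOpen O hOo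
  have hes : e.source = e₀.source ∩ O := e₀.restrOpen_source O hOo
  have hder : ∀ x ∈ e.source, ∃ g : A ≃L[ℝ] B, HasFDerivAt f (g : A →L[ℝ] B) x := by
    intro x hx
    rw [hes] at hx
    obtain ⟨g, hg⟩ := hx.2.2
    exact ⟨g, hg ▸ ((hf x hx.2.1).differentiableAt (by simp)).hasFDerivAt⟩
  refine ⟨e, ?_, ?_, he₀, ?_, hder⟩
  · rw [hes]
    exact ⟨(hf a ha).mem_toOpenPartialHomeomorph_source hf' (by simp), haO⟩
  · rw [hes]
    exact fun x hx => hx.2.1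
  · intro y hy
    have hx := e.map_target hy
    obtain ⟨g, hg⟩ := hder _ hx
    rw [hes] at hx
    exact e.contDiffAt_symm hy (f₀' := g) hg (hf _ hx.2.1)

section SingularEquation

variable {P W : Type} [NormedAddCommGroup P] [NormedAddCommGroup W]

/-- The function `t ↦ h (t l, p, u t)` on the unit interval: the right-hand side of a singular
equation along `u`, after the independent variable `x = t l` is rescaled to `t ∈ [0, 1]`. -/
def rescaledRhs (h : C(ℝ × P × W, W)) (q : ℝ × P) (u : C(I, W)) : C(I, W) :=
  h.comp ⟨fun t => ((t : ℝ) * q.1, q.2, u t), by fun_prop⟩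

@[simp] lemma rescaledRhs_apply (h : C(ℝ × P × W, W)) (q : ℝ × P) (u : C(I, W)) (t : I) :
    rescaledRhs h q u t = h ((t : ℝ) * q.1, q.2, u t) := rfl

lemma dilate_rescaledRhs (h : C(ℝ × P × W, W)) (q : ℝ × P) (u : C(I, W)) (s : I) :
    dilate s (rescaledRhs h q u) = rescaledRhs h ((s : ℝ) * q.1, q.2) (dilate s u) := by
  ext t
  simp only [dilate_apply, rescaledRhs_apply]
  congr 2
  push_cast
  ring

variable [NormedSpace ℝ P] [NormedSpace ℝ W]

/-- The rescaled right-hand side is smooth in `(l, p)` and `u` jointly. At `l = 0` and a constant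
`u`, its derivative in `u` acts pointwise by the partial derivative of `h`. -/
lemma contDiff_rescaledRhs (h : C(ℝ × P × W, W)) (hh : ContDiff ℝ ∞ h) :
    ContDiff ℝ ∞ (fun z : (ℝ × P) × C(I, W) => rescaledRhs h z.1 z.2) ∧
    ∀ (p₀ : P) (w₀ : W), ∃ L : ℝ × P →L[ℝ] C(I, W),
      HasFDerivAt (fun z : (ℝ × P) × C(I, W) => rescaledRhs h z.1 z.2)
        (L.comp (ContinuousLinearMap.fst ℝ _ _) +
          (((fderiv ℝ h (0, p₀, w₀)).comp ((ContinuousLinearMap.inr ℝ ℝ (P × W)).comp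
            (ContinuousLinearMap.inr ℝ P W))).compLeftContinuous ℝ I).comp
            (ContinuousLinearMap.snd ℝ _ _)) ((0, p₀), ContinuousMap.const I w₀) := by
  let c : C(I, ℝ × P →L[ℝ] ℝ × P × W) :=
    ⟨fun s => (s : ℝ) • (ContinuousLinearMap.inl ℝ ℝ (P × W)).comp
        (ContinuousLinearMap.fst ℝ ℝ P) +
      ((ContinuousLinearMap.inr ℝ ℝ (P × W)).comp (ContinuousLinearMap.inl ℝ P W)).comp
        (ContinuousLinearMap.snd ℝ ℝ P), by fun_prop⟩
  let C1 : ℝ × P →L[ℝ] C(I, ℝ × P × W) :=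
    (pointwiseApply I _ _ c).comp (ContinuousLinearMap.const ℝ I)
  let C2 : C(I, W) →L[ℝ] C(I, ℝ × P × W) :=
    ((ContinuousLinearMap.inr ℝ ℝ (P × W)).comp
      (ContinuousLinearMap.inr ℝ P W)).compLeftContinuous ℝ I
  let C : (ℝ × P) × C(I, W) →L[ℝ] C(I, ℝ × P × W) :=
    C1.comp (ContinuousLinearMap.fst ℝ _ _) + C2.comp (ContinuousLinearMap.snd ℝ _ _)
  have hC : (fun z : (ℝ × P) × C(I, W) => rescaledRhs h z.1 z.2) = fun z => h.comp (C z) := by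
    funext z
    ext t
    rw [rescaledRhs_apply, ContinuousMap.comp_apply]
    congr 1
    simp [C, C1, C2, c]
  rw [hC]
  refine ⟨(contDiff_superposition (n := ⊤) h hh).comp C.contDiff, fun p₀ w₀ => ?_⟩
  have hh' : Continuous (fderiv ℝ h) := hh.continuous_fderiv (by simp)
  have hd := (hasFDerivAt_superposition h ⟨fderiv ℝ h, hh'⟩
    (fun x => ((hh.differentiable (by simp)) x).hasFDerivAt)
    (C ((0, p₀), ContinuousMap.const I w₀))).comp _ C.hasFDerivAt
  refine ⟨(pointwiseApply I _ _ ((⟨fderiv ℝ h, hh'⟩ : C(_, _)).comp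
    (C ((0, p₀), ContinuousMap.const I w₀)))).comp C1, hd.congr_fderiv ?_⟩
  have hbase : ∀ t, C ((0, p₀), ContinuousMap.const I w₀) t = (0, p₀, w₀) := by
    intro t
    simp [C, C1, C2, c]
  refine ContinuousLinearMap.ext fun z => ContinuousMap.ext fun t => ?_
  change fderiv ℝ h (C _ t) (C1 z.1 t + C2 z.2 t) =
    fderiv ℝ h (C _ t) (C1 z.1 t) + fderiv ℝ h (0, p₀, w₀) (0, 0, z.2 t)
  rw [map_add, hbase]
  rfl

/-- Parametrised solution of a singular integral equation `u = S (t ↦ h (t l, p, u t))`, where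
`S` commutes with dilations. Rescaling the interval `[0, l]` to `[0, 1]` makes the endpoint `l` a
parameter on the same footing as `p`, so that the implicit function theorem in `C([0, 1], W)`
gives a solution `Z (l, p) = u 1` that is smooth in `l` across the singular point `l = 0`. -/
theorem exists_smooth_singular_solution [CompleteSpace P] [CompleteSpace W]
    (h : C(ℝ × P × W, W)) (hh : ContDiff ℝ ∞ h) (S : C(I, W) →L[ℝ] C(I, W))
    (hS : ∀ s v, S (dilate s v) = dilate s (S v)) (p₀ : P) (w₀ : W)
    (hbase : S (ContinuousMap.const I (h (0, p₀, w₀))) = ContinuousMap.const I w₀)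
    (hunit : IsUnit (1 - S.comp (((fderiv ℝ h (0, p₀, w₀)).comp
      ((ContinuousLinearMap.inr ℝ ℝ (P × W)).comp
        (ContinuousLinearMap.inr ℝ P W))).compLeftContinuous ℝ I))) :
    ∃ (O : Set (ℝ × P)) (Z : ℝ × P → W), IsOpen O ∧ (0, p₀) ∈ O ∧
      (∀ q ∈ O, ContDiffAt ℝ ∞ Z q) ∧ Z (0, p₀) = w₀ ∧
      ∀ q ∈ O, ∃ u : C(I, W), (∀ t : I, u t = Z ((t : ℝ) * q.1, q.2)) ∧
        u = S (rescaledRhs h q u) := by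
  obtain ⟨hsm, hder⟩ := contDiff_rescaledRhs h hh
  obtain ⟨L, hL⟩ := hder p₀ w₀
  set N := S.comp (((fderiv ℝ h (0, p₀, w₀)).comp
      ((ContinuousLinearMap.inr ℝ ℝ (P × W)).comp
        (ContinuousLinearMap.inr ℝ P W))).compLeftContinuous ℝ I) with hN
  obtain ⟨M, hM⟩ := hunit
  let X := C(I, W)
  let Φ : (ℝ × P) × X → (ℝ × P) × X := fun z => (z.1, z.2 - S (rescaledRhs h z.1 z.2))
  have hΦ : ContDiff ℝ ∞ Φ := contDiff_fst.prodMk (contDiff_snd.sub (S.contDiff.comp hsm))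
  let z₀ : (ℝ × P) × X := ((0, p₀), ContinuousMap.const I w₀)
  have hΦz₀ : Φ z₀ = ((0, p₀), 0) := by
    have : rescaledRhs h (0, p₀) (ContinuousMap.const I w₀) =
        ContinuousMap.const I (h (0, p₀, w₀)) := by ext t; simp
    simp only [Φ, z₀, this, hbase, sub_self]
  have hMl : ∀ v : X, (M⁻¹ : (X →L[ℝ] X)ˣ).1 (v - N v) = v := by
    intro v
    have := DFunLike.congr_fun M.inv_mul v
    rwa [hM] at this
  have hMr : ∀ v : X, (M⁻¹ : (X →L[ℝ] X)ˣ).1 v - N ((M⁻¹ : (X →L[ℝ] X)ˣ).1 v) = v := by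
    intro v
    have := DFunLike.congr_fun M.mul_inv v
    rwa [hM] at this
  let Φ' : ((ℝ × P) × X) ≃L[ℝ] ((ℝ × P) × X) := ContinuousLinearEquiv.equivOfInverse
    ((ContinuousLinearMap.fst ℝ _ _).prod (ContinuousLinearMap.snd ℝ _ _ -
      ((S.comp L).comp (ContinuousLinearMap.fst ℝ _ _) + N.comp (ContinuousLinearMap.snd ℝ _ _))))
    ((ContinuousLinearMap.fst ℝ _ _).prod ((M⁻¹ : (X →L[ℝ] X)ˣ).1.comp
      (ContinuousLinearMap.snd ℝ _ _ + (S.comp L).comp (ContinuousLinearMap.fst ℝ _ _))))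
    (fun z => by
      refine Prod.ext rfl ?_
      change (M⁻¹ : (X →L[ℝ] X)ˣ).1 (z.2 - (S (L z.1) + N z.2) + S (L z.1)) = z.2
      rw [← sub_sub, sub_right_comm, sub_add_cancel, hMl])
    (fun z => by
      refine Prod.ext rfl ?_
      change (M⁻¹ : (X →L[ℝ] X)ˣ).1 (z.2 + S (L z.1)) - (S (L z.1) +
        N ((M⁻¹ : (X →L[ℝ] X)ˣ).1 (z.2 + S (L z.1)))) = z.2
      rw [← sub_sub, sub_right_comm, hMr, add_sub_cancel_right])
  have hΦ' : HasFDerivAt Φ (Φ' : (ℝ × P) × X →L[ℝ] (ℝ × P) × X) z₀ := by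
    refine HasFDerivAt.congr_fderiv (hasFDerivAt_fst.prodMk
      (hasFDerivAt_snd.sub (S.hasFDerivAt.comp z₀ hL))) ?_
    simp only [Φ', hN]
    ext z <;> simp
  obtain ⟨e, hz₀, -, he, hesm, -⟩ := exists_smooth_local_inverse isOpen_univ (mem_univ z₀)
    (fun z _ => hΦ.contDiffAt) hΦ'
  obtain ⟨ε, hε, hball⟩ := Metric.isOpen_iff.1 e.open_source z₀ hz₀
  have hz₀t : ((0, p₀), 0) ∈ e.target := by
    rw [← hΦz₀, ← he]
    exact e.map_source hz₀
  have hsymm₀ : e.symm ((0, p₀), 0) = z₀ := by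
    rw [← hΦz₀, ← he]
    exact e.left_inv hz₀
  let ι : ℝ × P → (ℝ × P) × X := fun q => (q, 0)
  have hι : ContDiff ℝ ∞ ι := contDiff_id.prodMk contDiff_const
  let O : Set (ℝ × P) := ι ⁻¹' (e.target ∩ e.symm ⁻¹' Metric.ball z₀ ε)
  let Z : ℝ × P → W := fun q => (e.symm (ι q)).2 1
  have hsol : ∀ q, ι q ∈ e.target → (e.symm (ι q)).1 = q ∧
      (e.symm (ι q)).2 = S (rescaledRhs h q (e.symm (ι q)).2) := by
    intro q hq
    have h1 := e.right_inv hq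
    rw [he] at h1
    have h2 : (e.symm (ι q)).1 = q := congrArg Prod.fst h1
    have h3 : (e.symm (ι q)).2 - S (rescaledRhs h (e.symm (ι q)).1 (e.symm (ι q)).2) = 0 :=
      congrArg Prod.snd h1
    rw [h2] at h3
    exact ⟨h2, sub_eq_zero.1 h3⟩
  refine ⟨O, Z, ?_, ?_, ?_, ?_, ?_⟩
  · exact (e.isOpen_inter_preimage_symm Metric.isOpen_ball).preimage hι.continuous
  · refine ⟨hz₀t, ?_⟩
    change e.symm ((0, p₀), 0) ∈ Metric.ball z₀ ε
    rw [hsymm₀]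
    exact Metric.mem_ball_self hε
  · intro q hq
    have h1 : ContDiffAt ℝ ∞ (fun q => (e.symm (ι q)).2) q :=
      ((hesm _ hq.1).comp q hι.contDiffAt).snd
    exact (ContinuousMap.evalCLM ℝ (1 : I)).contDiff.contDiffAt.comp q h1
  · change (e.symm ((0, p₀), 0)).2 1 = w₀
    rw [hsymm₀]
    rfl
  · intro q hq
    obtain ⟨hq1, hq2⟩ := hsol q hq.1
    refine ⟨(e.symm (ι q)).2, fun t => ?_, hq2⟩
    have hb : dist (e.symm (ι q)) z₀ < ε := hq.2
    rw [Prod.dist_eq, max_lt_iff, hq1, Prod.dist_eq, max_lt_iff] at hb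
    obtain ⟨⟨hb1, hb2⟩, hb3⟩ := hb
    set u : X := (e.symm (ι q)).2 with hu
    -- the dilated solution solves the equation with endpoint `t l`, hence is the one there
    have hmem : (((t : ℝ) * q.1, q.2), dilate t u) ∈ e.source := by
      refine hball ?_
      rw [Metric.mem_ball, Prod.dist_eq, max_lt_iff, Prod.dist_eq, max_lt_iff]
      refine ⟨⟨?_, hb2⟩, ?_⟩
      · rw [dist_eq_norm] at hb1 ⊢
        simp only [z₀, sub_zero] at hb1 ⊢
        rw [norm_mul, Real.norm_of_nonneg t.2.1]
        exact (mul_le_of_le_one_left (norm_nonneg _) t.2.2).trans_lt hb1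
      · rw [dist_eq_norm] at hb3 ⊢
        exact (norm_dilate_sub_const_le t u w₀).trans_lt hb3
    have himg : e (((t : ℝ) * q.1, q.2), dilate t u) = ι ((t : ℝ) * q.1, q.2) := by
      rw [he]
      refine Prod.ext rfl ?_
      change dilate t u - S (rescaledRhs h ((t : ℝ) * q.1, q.2) (dilate t u)) = 0
      rw [← dilate_rescaledRhs, hS, ← hq2, sub_self]
    have hinv := e.left_inv hmem
    rw [himg] at hinv
    change _ = (e.symm (ι ((t : ℝ) * q.1, q.2))).2 1
    rw [hinv]
    change u t = u (t * 1)
    rw [mul_one]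
end SingularEquation

/-! ### Singular ordinary differential equations with parameters -/

section BriotBouquet

lemma averaging_comp {V V' : Type*} [NormedAddCommGroup V] [NormedSpace ℝ V] [CompleteSpace V]
    [NormedAddCommGroup V'] [NormedSpace ℝ V'] [CompleteSpace V'] {κ : ℝ} (hκ : 1 ≤ κ)
    (A : V →L[ℝ] V') (v : C(I, V)) :
    averaging V' κ hκ (A.compLeftContinuous ℝ I v) =
      A.compLeftContinuous ℝ I (averaging V κ hκ v) := by
  ext t
  change averaging V' κ hκ (A.compLeftContinuous ℝ I v) t = A (averaging V κ hκ v t)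
  rw [averaging_apply, averaging_apply,
    ← A.intervalIntegral_comp_comm (averaging_integrable hκ v t 0 1)]
  refine intervalIntegral.integral_congr fun s _ => ?_
  exact (map_smul A _ _).symm

variable {P W₁ W₂ : Type} [NormedAddCommGroup P] [NormedSpace ℝ P] [CompleteSpace P]
  [NormedAddCommGroup W₁] [NormedSpace ℝ W₁] [CompleteSpace W₁]
  [NormedAddCommGroup W₂] [NormedSpace ℝ W₂] [CompleteSpace W₂]

/-- The inverse of `u ↦ t u' + (u₁, κ u₂)` on `C([0, 1], W₁ × W₂)`. -/
noncomputable def pairAveraging (W₁ W₂ : Type) [NormedAddCommGroup W₁] [NormedSpace ℝ W₁]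
    [NormedAddCommGroup W₂] [NormedSpace ℝ W₂] (κ : ℝ) (hκ : 1 ≤ κ) :
    C(I, W₁ × W₂) →L[ℝ] C(I, W₁ × W₂) :=
  ((ContinuousLinearMap.inl ℝ W₁ W₂).compLeftContinuous ℝ I).comp
    ((averaging W₁ 1 le_rfl).comp ((ContinuousLinearMap.fst ℝ W₁ W₂).compLeftContinuous ℝ I)) +
  ((ContinuousLinearMap.inr ℝ W₁ W₂).compLeftContinuous ℝ I).comp
    ((averaging W₂ κ hκ).comp ((ContinuousLinearMap.snd ℝ W₁ W₂).compLeftContinuous ℝ I))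

omit [CompleteSpace W₁] [CompleteSpace W₂] in
lemma pairAveraging_apply {κ : ℝ} (hκ : 1 ≤ κ) (v : C(I, W₁ × W₂)) (t : I) :
    pairAveraging W₁ W₂ κ hκ v t =
      (averaging W₁ 1 le_rfl ((ContinuousLinearMap.fst ℝ W₁ W₂).compLeftContinuous ℝ I v) t,
        averaging W₂ κ hκ ((ContinuousLinearMap.snd ℝ W₁ W₂).compLeftContinuous ℝ I v) t) := by
  simp [pairAveraging]

/-- Smooth parametrised solutions of `x z' + (z₁, κ z₂) = h (x, p, z)` near a point where the
right-hand side has nilpotent linearisation in `z`. -/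
theorem exists_smooth_singular_ode_solution {h : ℝ × P × (W₁ × W₂) → W₁ × W₂}
    (hh : ContDiff ℝ ∞ h) {κ : ℝ} (hκ : 1 ≤ κ) (p₀ : P) (w₀ : W₁ × W₂)
    (hbase : h (0, p₀, w₀) = (w₀.1, κ • w₀.2)) (A : W₂ →L[ℝ] W₂) (hA : ∀ w, A (A w) = 0)
    (hder : ∀ w : W₁ × W₂, fderiv ℝ h (0, p₀, w₀) (0, 0, w) = (0, A w.2)) :
    ∃ (O : Set (ℝ × P)) (Z : ℝ × P → W₁ × W₂), IsOpen O ∧ (0, p₀) ∈ O ∧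
      (∀ q ∈ O, ContDiffAt ℝ ∞ Z q) ∧
      ∀ q ∈ O, q.1 • fderiv ℝ Z q (1, 0) = h (q.1, q.2, Z q) - ((Z q).1, κ • (Z q).2) := by
  set S := pairAveraging W₁ W₂ κ hκ with hS
  have hκ0 : κ ≠ 0 := by positivity
  have hSd : ∀ s v, S (dilate s v) = dilate s (S v) := by
    intro s v
    ext1 t
    rw [dilate_apply, hS, pairAveraging_apply, pairAveraging_apply]
    have h1 := congrArg (fun u => u t) (averaging_dilate (V := W₁) le_rfl
      ((ContinuousLinearMap.fst ℝ W₁ W₂).compLeftContinuous ℝ I v) s)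
    have h2 := congrArg (fun u => u t) (averaging_dilate (V := W₂) hκ
      ((ContinuousLinearMap.snd ℝ W₁ W₂).compLeftContinuous ℝ I v) s)
    exact Prod.ext h1 h2
  have hSb : S (ContinuousMap.const I (h (0, p₀, w₀))) = ContinuousMap.const I w₀ := by
    ext1 t
    rw [hS, pairAveraging_apply, hbase]
    have h1 := congrArg (fun u => u t) (averaging_const (V := W₁) le_rfl w₀.1)
    have h2 := congrArg (fun u => u t) (averaging_const (V := W₂) hκ (κ • w₀.2))
    simp only [inv_one, one_smul, inv_smul_smul₀ hκ0] at h1 h2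
    exact Prod.ext h1 h2
  set N := S.comp (((fderiv ℝ h (0, p₀, w₀)).comp
      ((ContinuousLinearMap.inr ℝ ℝ (P × (W₁ × W₂))).comp
        (ContinuousLinearMap.inr ℝ P (W₁ × W₂)))).compLeftContinuous ℝ I) with hN
  have hNapp : ∀ v t, N v t = (0, averaging W₂ κ hκ (A.compLeftContinuous ℝ I
      ((ContinuousLinearMap.snd ℝ W₁ W₂).compLeftContinuous ℝ I v)) t) := by
    intro v t
    rw [hN, ContinuousLinearMap.comp_apply, hS, pairAveraging_apply]
    have e1 : (ContinuousLinearMap.fst ℝ W₁ W₂).compLeftContinuous ℝ I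
        (((fderiv ℝ h (0, p₀, w₀)).comp ((ContinuousLinearMap.inr ℝ ℝ (P × (W₁ × W₂))).comp
        (ContinuousLinearMap.inr ℝ P (W₁ × W₂)))).compLeftContinuous ℝ I v) = 0 := by
      ext t
      simp [hder]
    have e2 : (ContinuousLinearMap.snd ℝ W₁ W₂).compLeftContinuous ℝ I
        (((fderiv ℝ h (0, p₀, w₀)).comp ((ContinuousLinearMap.inr ℝ ℝ (P × (W₁ × W₂))).comp
        (ContinuousLinearMap.inr ℝ P (W₁ × W₂)))).compLeftContinuous ℝ I v) =
        A.compLeftContinuous ℝ I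
          ((ContinuousLinearMap.snd ℝ W₁ W₂).compLeftContinuous ℝ I v) := by
      ext t
      change (fderiv ℝ h (0, p₀, w₀) (0, 0, v t)).2 = A (v t).2
      rw [hder]
    rw [e1, e2, map_zero]
    rfl
  -- `averaging` commutes with the pointwise action of `A`, so `A ∘ A = 0` passes to `N`
  have hN2 : N * N = 0 := by
    ext1 v
    ext1 t
    rw [mul_apply_eq_comp, hNapp]
    have e1 : (ContinuousLinearMap.snd ℝ W₁ W₂).compLeftContinuous ℝ I (N v) =
        A.compLeftContinuous ℝ I (averaging W₂ κ hκ
          ((ContinuousLinearMap.snd ℝ W₁ W₂).compLeftContinuous ℝ I v)) := by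
      rw [← averaging_comp]
      ext t
      simp [hNapp]
    have e2 : A.compLeftContinuous ℝ I ((ContinuousLinearMap.snd ℝ W₁ W₂).compLeftContinuous ℝ I
        (N v)) = 0 := by
      rw [e1]
      ext t
      exact hA _
    rw [e2, map_zero]
    rfl
  have hunit : IsUnit (1 - N) := IsNilpotent.isUnit_one_sub ⟨2, by rw [pow_two, hN2]⟩
  obtain ⟨O, Z, hO, h0, hZ, -, hsol⟩ := exists_smooth_singular_solution ⟨h, hh.continuous⟩ hh S
    hSd p₀ w₀ hSb hunit
  -- `Z` is evaluated halfway along the curve with endpoint `2 x`, an interior point of `[0, 1]`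
  let d : ℝ × P → ℝ × P := fun q => (2 * q.1, q.2)
  have hd : Continuous d := by fun_prop
  refine ⟨O ∩ d ⁻¹' O, Z, hO.inter (hO.preimage hd), ⟨h0, by simpa [d] using h0⟩,
    fun q hq => hZ q hq.1, ?_⟩
  rintro ⟨x, p⟩ ⟨hq, hq2⟩
  obtain ⟨u, hu, hueq⟩ := hsol (d (x, p)) hq2
  let τ : I := ⟨1 / 2, by norm_num, by norm_num⟩
  have hτ0 : (0 : ℝ) < τ := by norm_num [τ]
  have hτ1 : (τ : ℝ) < 1 := by norm_num [τ]
  set v := rescaledRhs ⟨h, hh.continuous⟩ (d (x, p)) u with hv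
  obtain ⟨d₁, hd₁, hd₁e⟩ := averaging_ode (V := W₁) le_rfl
    ((ContinuousLinearMap.fst ℝ W₁ W₂).compLeftContinuous ℝ I v) τ hτ0 hτ1
  obtain ⟨d₂, hd₂, hd₂e⟩ := averaging_ode (V := W₂) hκ
    ((ContinuousLinearMap.snd ℝ W₁ W₂).compLeftContinuous ℝ I v) τ hτ0 hτ1
  have huτ : u τ = Z (x, p) := by
    rw [hu]
    simp [τ, d]
  have hvτ : v τ = h (x, p, Z (x, p)) := by
    rw [hv, rescaledRhs_apply, huτ]
    simp [τ, d]
  have hcomp : ∀ t, u t =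
      (averaging W₁ 1 le_rfl ((ContinuousLinearMap.fst ℝ W₁ W₂).compLeftContinuous ℝ I v) t,
        averaging W₂ κ hκ ((ContinuousLinearMap.snd ℝ W₁ W₂).compLeftContinuous ℝ I v) t) := by
    intro t
    rw [← pairAveraging_apply, ← hS, ← hueq]
  have hder1 : HasDerivAt (fun r : ℝ => u (projIcc 0 1 zero_le_one r)) (d₁, d₂) τ := by
    simp only [hcomp]
    exact hd₁.prodMk hd₂
  have hder2 : HasDerivAt (fun r : ℝ => u (projIcc 0 1 zero_le_one r))
      ((2 * x) • fderiv ℝ Z (x, p) (1, 0)) τ := by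
    have h1 : HasDerivAt (fun r : ℝ => (r * (2 * x), p)) ((2 * x) • ((1 : ℝ), (0 : P))) τ := by
      simpa using ((hasDerivAt_id (τ : ℝ)).mul_const (2 * x)).prodMk (hasDerivAt_const (τ : ℝ) p)
    have hτx : ((τ : ℝ) * (2 * x), p) = (x, p) := by simp [τ]
    have h2 : HasFDerivAt Z (fderiv ℝ Z (x, p)) ((τ : ℝ) * (2 * x), p) := by
      rw [hτx]
      exact ((hZ _ hq).differentiableAt (by simp)).hasFDerivAt
    have h3 := h2.comp_hasDerivAt (τ : ℝ) h1
    rw [map_smul] at h3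
    refine h3.congr_of_eventuallyEq ?_
    filter_upwards [Ioo_mem_nhds hτ0 hτ1] with r hr
    rw [hu, projIcc_of_mem zero_le_one ⟨hr.1.le, hr.2.le⟩]
    rfl
  have heq := hder2.unique hder1
  have hx : x • fderiv ℝ Z (x, p) (1, 0) = (τ : ℝ) • (d₁, d₂) := by
    rw [← heq, smul_smul]
    congr 1
    simp [τ]
  change x • fderiv ℝ Z (x, p) (1, 0) = h (x, p, Z (x, p)) - ((Z (x, p)).1, κ • (Z (x, p)).2)
  rw [hx, Prod.smul_mk, hd₁e, hd₂e, ← hvτ, ← huτ, hcomp τ, one_smul]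
  rfl

end BriotBouquet

/-! ### The characteristic system -/

section Characteristics

variable {E : Type} [NormedAddCommGroup E] [InnerProductSpace ℝ E]

/-- A smooth family of functionals on a Hilbert space is represented by a smooth family of
vectors. -/
lemma exists_smooth_riesz [CompleteSpace E] {D : Type*} [NormedAddCommGroup D] [NormedSpace ℝ D]
    {l : D → E →L[ℝ] ℝ} (hl : ContDiff ℝ ∞ l) :
    ∃ g : D → E, ContDiff ℝ ∞ g ∧ ∀ p v, inner ℝ (g p) v = l p v := by
  have hb : IsBoundedLinearMap ℝ (fun l : E →L[ℝ] ℝ => (InnerProductSpace.toDual ℝ E).symm l) :=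
    ⟨⟨fun a b => map_add _ _ _, fun r a => by simp⟩, 1, one_pos, fun x => by simp⟩
  exact ⟨fun p => (InnerProductSpace.toDual ℝ E).symm (l p), hb.contDiff.comp hl,
    fun p v => InnerProductSpace.toDual_symm_apply⟩

/-- The partial gradients in `y` and `q` and the partial derivative in `w` of a smooth function
of `(x, y, w, q)`. -/
lemma exists_partial_gradients [CompleteSpace E] {G : ℝ × E × ℝ × E → ℝ} (hG : ContDiff ℝ ∞ G) :
    ∃ (gy b : ℝ × E × ℝ × E → E) (gw : ℝ × E × ℝ × E → ℝ), ContDiff ℝ ∞ gy ∧ ContDiff ℝ ∞ b ∧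
      ContDiff ℝ ∞ gw ∧ ∀ p dy dw dq, fderiv ℝ G p (0, dy, dw, dq) =
        inner ℝ (gy p) dy + gw p * dw + inner ℝ (b p) dq := by
  have hd : ContDiff ℝ ∞ (fderiv ℝ G) := hG.fderiv_right (m := ∞) (by simp)
  let iy : E →L[ℝ] ℝ × E × ℝ × E :=
    (ContinuousLinearMap.inr ℝ ℝ (E × ℝ × E)).comp (ContinuousLinearMap.inl ℝ E (ℝ × E))
  let iq : E →L[ℝ] ℝ × E × ℝ × E :=
    (ContinuousLinearMap.inr ℝ ℝ (E × ℝ × E)).comp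
      ((ContinuousLinearMap.inr ℝ E (ℝ × E)).comp (ContinuousLinearMap.inr ℝ ℝ E))
  obtain ⟨gy, hgy, hgy'⟩ := exists_smooth_riesz (hd.clm_comp (contDiff_const (c := iy)))
  obtain ⟨b, hb, hb'⟩ := exists_smooth_riesz (hd.clm_comp (contDiff_const (c := iq)))
  refine ⟨gy, b, fun p => fderiv ℝ G p (0, 0, 1, 0), hgy, hb, hd.clm_apply contDiff_const,
    fun p dy dw dq => ?_⟩
  rw [hgy', hb']
  have : ((0 : ℝ), dy, dw, dq) = iy dy + dw • ((0 : ℝ), (0 : E), (1 : ℝ), (0 : E)) + iq dq := by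
    simp [iy, iq]
  rw [this, map_add, map_add, map_smul, smul_eq_mul]
  simp only [ContinuousLinearMap.comp_apply]
  ring

/-- The characteristic system of `x χₓ = -c(y) χ + x G(x, y, χ, ∂_y χ)`, started at the points
`(0, η, 0, 0)`, has a solution that is smooth in `(x, η)`. It is obtained in the form
`Y = η + x a`, `χ = x X`, `q = x Q`. -/
theorem exists_smooth_characteristics [CompleteSpace E] {c : E → ℝ} (hc : ContDiff ℝ ∞ c)
    {dc : E → E} (hdc : ContDiff ℝ ∞ dc)
    {G gw : ℝ × E × ℝ × E → ℝ} (hG : ContDiff ℝ ∞ G) (hgw : ContDiff ℝ ∞ gw)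
    {gy b : ℝ × E × ℝ × E → E} (hgy : ContDiff ℝ ∞ gy) (hb : ContDiff ℝ ∞ b) (y₀ : E)
    (hpos : 0 < c y₀) :
    ∃ (O : Set (ℝ × E)) (Y q : ℝ × E → E) (χ : ℝ × E → ℝ), IsOpen O ∧ (0, y₀) ∈ O ∧
      (∀ p ∈ O, ContDiffAt ℝ ∞ Y p ∧ ContDiffAt ℝ ∞ χ p ∧ ContDiffAt ℝ ∞ q p ∧
        fderiv ℝ Y p (1, 0) = -b (p.1, Y p, χ p, q p) ∧
        p.1 * fderiv ℝ χ p (1, 0) = -c (Y p) * χ p +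
          p.1 * (G (p.1, Y p, χ p, q p) - inner ℝ (q p) (b (p.1, Y p, χ p, q p))) ∧
        p.1 • fderiv ℝ q p (1, 0) = -c (Y p) • q p - χ p • dc (Y p) +
          p.1 • (gy (p.1, Y p, χ p, q p) + gw (p.1, Y p, χ p, q p) • q p)) ∧
      ∀ y, Y (0, y) = y ∧ χ (0, y) = 0 ∧ q (0, y) = 0 := by
  let pt : ℝ × E × (E × (ℝ × E)) → ℝ × E × ℝ × E := fun z =>
    (z.1, z.2.1 + z.1 • z.2.2.1, z.1 * z.2.2.2.1, z.1 • z.2.2.2.2)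
  have hpt : ContDiff ℝ ∞ pt := by fun_prop
  -- Only the frozen coefficient `c y₀` is kept on the left-hand side. The remaining `c y₀ - c` vanishes
  -- at the base point, so that the linearisation there is `(a, X, Q) ↦ (0, 0, -X dc)`.
  let h : ℝ × E × (E × (ℝ × E)) → E × (ℝ × E) := fun z =>
    (-b (pt z), ((c y₀ - c (pt z).2.1) * z.2.2.2.1 + (G (pt z) - inner ℝ (pt z).2.2.2 (b (pt z))),
      (c y₀ - c (pt z).2.1) • z.2.2.2.2 - z.2.2.2.1 • dc (pt z).2.1 +
        (gy (pt z) + gw (pt z) • (pt z).2.2.2)))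
  have hh : ContDiff ℝ ∞ h := by
    have h1 := hb.comp hpt
    have h2 := hG.comp hpt
    have h3 := hgy.comp hpt
    have h4 := hgw.comp hpt
    have h5 : ContDiff ℝ ∞ fun z => (pt z).2.1 := by fun_prop
    have h6 : ContDiff ℝ ∞ fun z => (pt z).2.2.2 := by fun_prop
    have h7 := hc.comp h5
    have h8 := hdc.comp h5
    have h9 : ContDiff ℝ ∞ fun z : ℝ × E × (E × (ℝ × E)) => z.2.2.2.1 := by fun_prop
    have h10 : ContDiff ℝ ∞ fun z : ℝ × E × (E × (ℝ × E)) => z.2.2.2.2 := by fun_prop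
    exact h1.neg.prodMk ((((contDiff_const.sub h7).mul h9).add (h2.sub (h6.inner ℝ h1))).prodMk
      ((((contDiff_const.sub h7).smul h10).sub (h9.smul h8)).add (h3.add (h4.smul h6))))
  set κ : ℝ := 1 + c y₀ with hκ
  have hκ0 : κ ≠ 0 := by positivity
  set z₀ : ℝ × E × ℝ × E := (0, y₀, 0, 0) with hz₀
  have hhz : ∀ w : E × (ℝ × E), h (0, y₀, w) = (-b z₀, (G z₀, -(w.2.1 • dc y₀) + gy z₀)) := by
    intro w
    simp [h, pt, hz₀]
  -- the value at `x = 0` of the solution: `-b = a`, `G = κ X`, `G_y - X dc = κ Q`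
  let w₀ : E × (ℝ × E) := (-b z₀, (κ⁻¹ * G z₀,
    κ⁻¹ • (-((κ⁻¹ * G z₀) • dc y₀) + gy z₀)))
  let A : ℝ × E →L[ℝ] ℝ × E := (ContinuousLinearMap.inr ℝ ℝ E).comp
    ((ContinuousLinearMap.fst ℝ ℝ E).smulRight (-dc y₀))
  obtain ⟨O, Z, hO, h0, hZ, hode⟩ := exists_smooth_singular_ode_solution hh (κ := κ)
    (by linarith) y₀ w₀ (by
      rw [hhz]
      simp [w₀, smul_smul, hκ0]) A (fun w => by simp [A]) (fun w => by
      have h1 : HasDerivAt (fun s : ℝ => ((0 : ℝ), y₀, w₀ + s • w)) (0, 0, w) 0 := by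
        simpa using (hasDerivAt_const (0:ℝ) (0:ℝ)).prodMk ((hasDerivAt_const (0:ℝ) y₀).prodMk
          (((hasDerivAt_id (0:ℝ)).smul_const w).const_add w₀))
      have h2 := (hh.differentiable (by simp) (0, y₀, w₀ + (0:ℝ) • w)).hasFDerivAt.comp_hasDerivAt
        (0:ℝ) h1
      have h3 : HasDerivAt (fun s : ℝ => h (0, y₀, w₀ + s • w))
          ((0 : E), ((0 : ℝ), -(w.2.1 • dc y₀))) 0 := by
        simp only [hhz]
        refine (hasDerivAt_const _ _).prodMk ((hasDerivAt_const _ _).prodMk ?_)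
        have h4 : HasDerivAt (fun s : ℝ => (w₀.2.1 + s * w.2.1)) (w.2.1) 0 := by
          simpa using ((hasDerivAt_id (0:ℝ)).mul_const w.2.1).const_add w₀.2.1
        simpa using ((h4.smul_const (dc y₀)).neg.add_const (gy z₀))
      rw [zero_smul, add_zero] at h2
      rw [h2.unique h3]
      simp [A])
  refine ⟨O, fun p => p.2 + p.1 • (Z p).1, fun p => p.1 • (Z p).2.2, fun p => p.1 * (Z p).2.1,
    hO, h0, fun p hp => ?_, fun y => by simp⟩
  have hZp := hZ p hp
  have hZd : HasFDerivAt Z (fderiv ℝ Z p) p := (hZp.differentiableAt (by simp)).hasFDerivAt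
  have hfst : HasFDerivAt (fun p : ℝ × E => p.1) (ContinuousLinearMap.fst ℝ ℝ E) p :=
    hasFDerivAt_fst
  have hY : HasFDerivAt (fun p : ℝ × E => p.2 + p.1 • (Z p).1) _ p :=
    (hasFDerivAt_snd (𝕜 := ℝ) (p := p)).add (hfst.smul hZd.fst)
  have hχ : HasFDerivAt (fun p : ℝ × E => p.1 * (Z p).2.1) _ p := hfst.mul hZd.snd.fst
  have hq : HasFDerivAt (fun p : ℝ × E => p.1 • (Z p).2.2) _ p := hfst.smul hZd.snd.snd
  have hode := hode p hp
  have hode1 := congrArg Prod.fst hode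
  have hode2 := congrArg (fun z => z.2.1) hode
  have hode3 := congrArg (fun z => z.2.2) hode
  simp only [Prod.smul_fst, Prod.smul_snd, Prod.fst_sub, Prod.snd_sub, h, pt] at hode1 hode2 hode3
  refine ⟨by fun_prop, by fun_prop, by fun_prop, ?_, ?_, ?_⟩
  · rw [hY.fderiv]
    simp [hode1]
  · rw [hχ.fderiv]
    simp only [smul_eq_mul] at hode2
    simp
    linear_combination p.1 * hode2 + p.1 * (Z p).2.1 * hκ
  · rw [hq.fderiv]
    simp [hode3]
    rw [hκ]
    module

end Characteristics

/-! ### The contact form and the reduced equation -/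

section Envelope

variable {E : Type} [NormedAddCommGroup E] [InnerProductSpace ℝ E]

lemma hasDerivAt_line {V : Type*} [NormedAddCommGroup V] [NormedSpace ℝ V] {f : ℝ × E → V}
    {x : ℝ} {y : E} (hf : ContDiffAt ℝ ∞ f (x, y)) (e : E) :
    HasDerivAt (fun s : ℝ => f (x, y + s • e)) (fderiv ℝ f (x, y) (0, e)) 0 := by
  have h1 : HasDerivAt (fun s : ℝ => (x, y + s • e)) ((0 : ℝ), e) 0 := by
    simpa using (hasDerivAt_const (0:ℝ) x).prodMk
      (((hasDerivAt_id (0:ℝ)).smul_const e).const_add y)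
  have h2 : HasFDerivAt f (fderiv ℝ f (x, y)) (x, y + (0:ℝ) • e) := by
    simpa using (hf.differentiableAt (by simp)).hasFDerivAt
  exact h2.comp_hasDerivAt (0:ℝ) h1

lemma hasDerivAt_fst {V : Type*} [NormedAddCommGroup V] [NormedSpace ℝ V] {f : ℝ × E → V}
    {x : ℝ} {y : E} (hf : ContDiffAt ℝ ∞ f (x, y)) :
    HasDerivAt (fun s : ℝ => f (s, y)) (fderiv ℝ f (x, y) (1, 0)) x :=
  (hf.differentiableAt (by simp)).hasFDerivAt.comp_hasDerivAt x
    ((hasDerivAt_id x).prodMk (hasDerivAt_const x y))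

/-- The mixed second derivative, as the derivative of either first partial derivative. -/
lemma exists_hasDerivAt_mixed {V : Type*} [NormedAddCommGroup V] [NormedSpace ℝ V]
    {f : ℝ × E → V} {x : ℝ} {y : E} (hf : ContDiffAt ℝ ∞ f (x, y)) (e : E) :
    ∃ m, HasDerivAt (fun s : ℝ => fderiv ℝ f (s, y) (0, e)) m x ∧
      HasDerivAt (fun s : ℝ => fderiv ℝ f (x, y + s • e) (1, 0)) m 0 := by
  have hd : ContDiffAt ℝ ∞ (fderiv ℝ f) (x, y) := hf.fderiv_right (m := ∞) (by simp)
  have h1 := (hasDerivAt_fst hd).clm_apply (hasDerivAt_const x ((0 : ℝ), e))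
  have h2 := (hasDerivAt_line hd e).clm_apply (hasDerivAt_const (0:ℝ) ((1 : ℝ), (0 : E)))
  have hsymm := ((hf.of_le (WithTop.coe_le_coe.2 le_top : ((2 : ℕ∞) : WithTop ℕ∞) ≤ ∞)).isSymmSndFDerivAt
    (by simp)).eq (1, 0) (0, e)
  simp only [map_zero, add_zero] at h1 h2
  rw [← hsymm] at h2
  exact ⟨_, h1, h2⟩

/-- The contact form `dχ - ⟨q, dY⟩` satisfies a scalar linear equation along characteristics. -/
lemma contactForm_ode {c : E → ℝ} (hc : ContDiff ℝ ∞ c) {dc : E → E}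
    (hdc : ∀ y v, inner ℝ (dc y) v = fderiv ℝ c y v)
    {G gw : ℝ × E × ℝ × E → ℝ} (hG : ContDiff ℝ ∞ G) {gy b : ℝ × E × ℝ × E → E}
    (hb : ContDiff ℝ ∞ b)
    (hgrad : ∀ p dy dw dq, fderiv ℝ G p (0, dy, dw, dq) =
        inner ℝ (gy p) dy + gw p * dw + inner ℝ (b p) dq)
    {O : Set (ℝ × E)} (hO : IsOpen O) {Y q : ℝ × E → E} {χ : ℝ × E → ℝ}
    (hsys : ∀ p ∈ O, ContDiffAt ℝ ∞ Y p ∧ ContDiffAt ℝ ∞ χ p ∧ ContDiffAt ℝ ∞ q p ∧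
        fderiv ℝ Y p (1, 0) = -b (p.1, Y p, χ p, q p) ∧
        p.1 * fderiv ℝ χ p (1, 0) = -c (Y p) * χ p +
          p.1 * (G (p.1, Y p, χ p, q p) - inner ℝ (q p) (b (p.1, Y p, χ p, q p))) ∧
        p.1 • fderiv ℝ q p (1, 0) = -c (Y p) • q p - χ p • dc (Y p) +
          p.1 • (gy (p.1, Y p, χ p, q p) + gw (p.1, Y p, χ p, q p) • q p))
    {x : ℝ} {y : E} (hp : (x, y) ∈ O) (e : E) :
    ∃ r', HasDerivAt (fun s => fderiv ℝ χ (s, y) (0, e) -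
        inner ℝ (q (s, y)) (fderiv ℝ Y (s, y) (0, e))) r' x ∧
      x * r' = (-c (Y (x, y)) + x * gw (x, Y (x, y), χ (x, y), q (x, y))) *
        (fderiv ℝ χ (x, y) (0, e) - inner ℝ (q (x, y)) (fderiv ℝ Y (x, y) (0, e))) := by
  obtain ⟨hY, hχ, hq, -, -, hqx⟩ := hsys _ hp
  obtain ⟨mY, hmY1, hmY2⟩ := exists_hasDerivAt_mixed hY e
  obtain ⟨mχ, hmχ1, hmχ2⟩ := exists_hasDerivAt_mixed hχ e
  have hYe := hasDerivAt_line hY e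
  have hχe := hasDerivAt_line hχ e
  have hqe := hasDerivAt_line hq e
  have hnear : ∀ᶠ s : ℝ in 𝓝 0, (x, y + s • e) ∈ O := by
    have hc : ContinuousAt (fun s : ℝ => (x, y + s • e)) 0 := by fun_prop
    exact hc.eventually (hO.mem_nhds (by simpa using hp))
  have hpt := (hasDerivAt_const (0:ℝ) x).prodMk (hYe.prodMk (hχe.prodMk hqe))
  set Ye := fderiv ℝ Y (x, y) (0, e)
  set χe := fderiv ℝ χ (x, y) (0, e)
  set qe := fderiv ℝ q (x, y) (0, e)
  set pt : ℝ × E × ℝ × E := (x, Y (x, y), χ (x, y), q (x, y)) with hptdef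
  have hpt0 : (x, Y (x, y + (0:ℝ) • e), χ (x, y + (0:ℝ) • e), q (x, y + (0:ℝ) • e)) = pt := by
    simp [hptdef]
  have hGe : HasDerivAt (fun s : ℝ => G (x, Y (x, y + s • e), χ (x, y + s • e),
      q (x, y + s • e))) (fderiv ℝ G pt (0, Ye, χe, qe)) 0 := by
    refine HasFDerivAt.comp_hasDerivAt (0:ℝ) ?_ hpt
    rw [hpt0]
    exact (hG.differentiable (by simp) pt).hasFDerivAt
  have hbe : HasDerivAt (fun s : ℝ => b (x, Y (x, y + s • e), χ (x, y + s • e),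
      q (x, y + s • e))) (fderiv ℝ b pt (0, Ye, χe, qe)) 0 := by
    refine HasFDerivAt.comp_hasDerivAt (0:ℝ) ?_ hpt
    rw [hpt0]
    exact (hb.differentiable (by simp) pt).hasFDerivAt
  have hce : HasDerivAt (fun s : ℝ => c (Y (x, y + s • e))) (fderiv ℝ c (Y (x, y)) Ye) 0 := by
    refine HasFDerivAt.comp_hasDerivAt (0:ℝ) ?_ hYe
    simpa using (hc.differentiable (by simp) (Y (x, y))).hasFDerivAt
  set be := fderiv ℝ b pt (0, Ye, χe, qe)
  -- the `x`-derivatives of `Y` and `χ` are given by the characteristic system, which can be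
  -- differentiated in the direction `e`
  have hmY : mY = -be := by
    refine hmY2.unique (hbe.neg.congr_of_eventuallyEq ?_)
    filter_upwards [hnear] with s hs using (hsys _ hs).2.2.2.1
  have hmχ := (hmχ2.const_mul x).unique (((hce.neg.mul hχe).add
    ((hGe.sub (hqe.inner ℝ hbe)).const_mul x)).congr_of_eventuallyEq (by
      filter_upwards [hnear] with s hs using (hsys _ hs).2.2.2.2.1))
  simp only [zero_smul, add_zero, Pi.neg_apply] at hmχ
  rw [← hptdef, hgrad, ← hdc] at hmχ
  refine ⟨_, hmχ1.sub ((hasDerivAt_fst hq).inner ℝ hmY1), ?_⟩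
  have hqY := congrArg (fun v => inner ℝ v Ye) hqx
  simp only [inner_add_left, inner_sub_left, real_inner_smul_left] at hqY
  rw [hmY, inner_neg_right]
  rw [real_inner_comm qe (b pt)] at hmχ
  linear_combination hmχ - hqY

/-- A solution of `x r' = -a r` with `a ≥ 0` and `r 0 = 0` vanishes for `x ≥ 0`, because `r ^ 2` is
nonincreasing. -/
lemma eq_zero_of_singular_ode {r a : ℝ → ℝ} {ε : ℝ} (h0 : r 0 = 0)
    (hr : ∀ x ∈ Ico 0 ε, ∃ r', HasDerivAt r r' x ∧ x * r' = -a x * r x)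
    (ha : ∀ x ∈ Ico 0 ε, 0 ≤ a x) {x : ℝ} (hx : x ∈ Ico 0 ε) : r x = 0 := by
  have hanti : AntitoneOn (fun s => r s ^ 2) (Icc 0 x) := by
    refine antitoneOn_of_deriv_nonpos (convex_Icc 0 x) (fun s hs => ?_) (fun s hs => ?_)
      (fun s hs => ?_)
    · obtain ⟨r', h1, -⟩ := hr s ⟨hs.1, hs.2.trans_lt hx.2⟩
      exact (h1.continuousAt.pow 2).continuousWithinAt
    · rw [interior_Icc] at hs
      obtain ⟨r', h1, -⟩ := hr s ⟨hs.1.le, hs.2.trans hx.2⟩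
      exact (h1.pow 2).differentiableAt.differentiableWithinAt
    · rw [interior_Icc] at hs
      have hs' : s ∈ Ico 0 ε := ⟨hs.1.le, hs.2.trans hx.2⟩
      obtain ⟨r', h1, h2⟩ := hr s hs'
      have h3 := (h1.pow 2).deriv
      have h4 : deriv (fun s => r s ^ 2) s = 2 * r s * r' := by
        rw [show (fun s => r s ^ 2) = r ^ 2 from rfl, h3]
        norm_num
      rw [h4]
      refine nonpos_of_mul_nonpos_right (a := s) ?_ hs.1
      have := mul_nonneg (ha s hs') (sq_nonneg (r s))
      linear_combination 2 * r s * h2 + 2 * this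
  have h := hanti ⟨le_rfl, hx.1⟩ ⟨hx.1, le_rfl⟩ hx.1
  simp only [h0] at h
  exact pow_eq_zero_iff (two_ne_zero) |>.1 (le_antisymm (by simpa using h) (sq_nonneg _))

/-- Local solvability of the reduced equation `x χₓ = -c(y) χ + x G(x, y, χ, ∂_y χ)` with `c > 0`:
the characteristic system is solved from every point `(0, η)`, the resulting functions are carried
back along `(x, η) ↦ (x, Y (x, η))`, and vanishing of the contact form identifies `q` with the
gradient of the solution. -/
theorem exists_smooth_reduced_solution [CompleteSpace E] {c : E → ℝ} (hc : ContDiff ℝ ∞ c)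
    {G : ℝ × E × ℝ × E → ℝ} (hG : ContDiff ℝ ∞ G) (y₀ : E) (hpos : 0 < c y₀) :
    ∃ (O : Set (ℝ × E)) (f : ℝ × E → ℝ), IsOpen O ∧ (0, y₀) ∈ O ∧
      (∀ p ∈ O, ContDiffAt ℝ ∞ f p) ∧ ∀ x y, (x, y) ∈ O → 0 ≤ x →
        x * fderiv ℝ f (x, y) (1, 0) =
          -c y * f (x, y) + x * G (x, y, f (x, y), gradient (fun z => f (x, z)) y) := by
  obtain ⟨gy, b, gw, hgy, hb, hgw, hgrad⟩ := exists_partial_gradients hG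
  obtain ⟨dc, hdc, hdc'⟩ := exists_smooth_riesz (hc.fderiv_right (m := ∞) (by simp))
  obtain ⟨O₁, Y, q, χ, hO₁, h0, hsys, hinit⟩ :=
    exists_smooth_characteristics hc hdc hG hgw hgy hb y₀ hpos
  -- the coefficient in the equation of the contact form, positive near the base point
  let a : ℝ × E → ℝ := fun p => c (Y p) - p.1 * gw (p.1, Y p, χ p, q p)
  have ha : ContinuousAt a (0, y₀) := by
    obtain ⟨h1, h2, h3, -⟩ := hsys _ h0
    have h1 := h1.continuousAt
    have h2 := h2.continuousAt
    have h3 := h3.continuousAt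
    have hfst : ContinuousAt (fun p : ℝ × E => p.1) (0, y₀) := continuousAt_fst
    exact (hc.continuous.continuousAt.comp h1).sub (hfst.mul (ContinuousAt.comp
      (g := gw) hgw.continuous.continuousAt (hfst.prodMk (h1.prodMk (h2.prodMk h3)))))
  have ha0 : 0 < a (0, y₀) := by
    simpa [a, (hinit y₀).1] using hpos
  obtain ⟨ε, hε, hball⟩ := Metric.mem_nhds_iff.1
    (inter_mem (hO₁.mem_nhds h0) (ha.eventually_const_lt ha0))
  set U : Set (ℝ × E) := Metric.ball (0, y₀) ε with hU
  have hmemU : ∀ x y, (x, y) ∈ U → 0 ≤ x → ∀ s ∈ Ico 0 ε, (s, y) ∈ U := by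
    intro x y hxy _ s hs
    rw [hU, Metric.mem_ball, Prod.dist_eq, max_lt_iff] at hxy ⊢
    refine ⟨?_, hxy.2⟩
    rw [Real.dist_eq, sub_zero, abs_of_nonneg hs.1]
    exact hs.2
  have hcontact : ∀ x y, (x, y) ∈ U → 0 ≤ x → ∀ e : E,
      fderiv ℝ χ (x, y) (0, e) = inner ℝ (q (x, y)) (fderiv ℝ Y (x, y) (0, e)) := by
    intro x y hxy hx e
    have hxε : x ∈ Ico 0 ε := by
      refine ⟨hx, ?_⟩
      rw [hU, Metric.mem_ball, Prod.dist_eq, max_lt_iff] at hxy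
      have := hxy.1
      rwa [Real.dist_eq, sub_zero, abs_of_nonneg hx] at this
    have h := eq_zero_of_singular_ode (ε := ε) (x := x) (a := fun s => a (s, y))
      (r := fun s => fderiv ℝ χ (s, y) (0, e) - inner ℝ (q (s, y)) (fderiv ℝ Y (s, y) (0, e)))
      ?_ ?_ ?_ hxε
    · exact sub_eq_zero.1 h
    · have hmem : (0, y) ∈ O₁ := (hball (hmemU x y hxy hx 0 ⟨le_rfl, hε⟩)).1
      have h1 := hasDerivAt_line (hsys _ hmem).2.1 e
      simp only [(hinit _).2.1] at h1
      have h2 := h1.unique (hasDerivAt_const _ _)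
      simp only [h2, (hinit _).2.2, inner_zero_left, sub_zero]
    · intro s hs
      obtain ⟨r', h1, h2⟩ := contactForm_ode hc hdc' hG hb hgrad hO₁
        hsys (hball (hmemU x y hxy hx s hs)).1 e
      refine ⟨r', h1, h2.trans ?_⟩
      simp only [a]
      ring
    · intro s hs
      exact (hball (hmemU x y hxy hx s hs)).2.le
  let Ψ : ℝ × E → ℝ × E := fun p => (p.1, Y p)
  have hΨ : ∀ p ∈ U, ContDiffAt ℝ ∞ Ψ p := fun p hp =>
    contDiffAt_fst.prodMk (hsys p (hball hp).1).1
  have hΨd : ∀ p ∈ U, HasFDerivAt Ψ ((ContinuousLinearMap.fst ℝ ℝ E).prod (fderiv ℝ Y p)) p :=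
    fun p hp => hasFDerivAt_fst.prodMk
      ((hsys p (hball hp).1).1.differentiableAt (by simp)).hasFDerivAt
  have h0U : (0, y₀) ∈ U := Metric.mem_ball_self hε
  -- `Y (0, η) = η`, so the derivative of `Ψ` at the base point is unipotent
  have hYe : ∀ e, fderiv ℝ Y (0, y₀) (0, e) = e := by
    intro e
    have h1 := hasDerivAt_line (hsys _ h0).1 e
    simp only [(hinit _).1] at h1
    have h2 := ((hasDerivAt_id (0:ℝ)).smul_const e).const_add y₀
    simpa using h1.unique h2
  have hYv : ∀ v : ℝ × E, fderiv ℝ Y (0, y₀) v = v.1 • fderiv ℝ Y (0, y₀) (1, 0) + v.2 := by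
    intro v
    conv_lhs => rw [show v = v.1 • ((1 : ℝ), (0 : E)) + (0, v.2) by simp]
    rw [map_add, map_smul, hYe]
  let Ψ' : (ℝ × E) ≃L[ℝ] ℝ × E := ContinuousLinearEquiv.equivOfInverse
    ((ContinuousLinearMap.fst ℝ ℝ E).prod (fderiv ℝ Y (0, y₀)))
    ((ContinuousLinearMap.fst ℝ ℝ E).prod (ContinuousLinearMap.snd ℝ ℝ E -
      (ContinuousLinearMap.fst ℝ ℝ E).smulRight (fderiv ℝ Y (0, y₀) (1, 0))))
    (fun v => by
      refine Prod.ext rfl ?_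
      change fderiv ℝ Y (0, y₀) v - v.1 • fderiv ℝ Y (0, y₀) (1, 0) = v.2
      rw [hYv v, add_sub_cancel_left])
    (fun v => by
      refine Prod.ext rfl ?_
      change fderiv ℝ Y (0, y₀) (v.1, v.2 - v.1 • fderiv ℝ Y (0, y₀) (1, 0)) = v.2
      rw [hYv]
      simp)
  obtain ⟨e, he0, hesub, he, hesm, heder⟩ := exists_smooth_local_inverse Metric.isOpen_ball h0U hΨ
    (f' := Ψ') (hΨd _ h0U)
  have hfsm : ∀ p ∈ e.target, ContDiffAt ℝ ∞ (fun p => χ (e.symm p)) p := fun p hp =>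
    (hsys _ (hball (hesub (e.map_target hp))).1).2.1.comp p (hesm p hp)
  refine ⟨e.target, fun p => χ (e.symm p), e.open_target, ?_, hfsm, ?_⟩
  · have := e.map_source he0
    rw [he] at this
    simpa [Ψ, (hinit y₀).1] using this
  intro x y hxy hx
  have hfd := ((hfsm _ hxy).differentiableAt (by simp)).hasFDerivAt
  set f : ℝ × E → ℝ := fun p => χ (e.symm p) with hf
  have hsrc := e.map_target hxy
  have hΨp : Ψ (e.symm (x, y)) = (x, y) := by
    rw [← he]
    exact e.right_inv hxy
  obtain ⟨x', η, hp⟩ : ∃ x' η, e.symm (x, y) = (x', η) := ⟨_, _, rfl⟩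
  have hfp : f (x, y) = χ (x', η) := by simp only [hf, hp]
  rw [hp] at hsrc hΨp
  obtain rfl : x' = x := congrArg Prod.fst hΨp
  have hYη : Y (x', η) = y := congrArg Prod.snd hΨp
  have hU' := hesub hsrc
  -- the chain rule for `χ = f ∘ Ψ`
  have hchain : ∀ v : ℝ × E, fderiv ℝ χ (x', η) v =
      fderiv ℝ f (x', y) (v.1, fderiv ℝ Y (x', η) v) := by
    have h1 : HasFDerivAt f (fderiv ℝ f (x', y)) (Ψ (x', η)) := by rwa [hΨp]
    have h2 := (h1.comp _ (hΨd _ hU')).congr_of_eventuallyEq (f₁ := χ) (by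
      filter_upwards [e.open_source.mem_nhds hsrc] with p hps
      have := e.left_inv hps
      rw [he] at this
      simp [hf, this])
    intro v
    rw [h2.fderiv]
    rfl
  -- every `v` is `∂_η Y v'`, and there the contact form vanishes
  have hgradf : ∀ v : E, fderiv ℝ f (x', y) (0, v) = inner ℝ (q (x', η)) v := by
    intro v
    obtain ⟨g, hg⟩ := heder _ hsrc
    have hgv : ((ContinuousLinearMap.fst ℝ ℝ E).prod (fderiv ℝ Y (x', η))) (g.symm (0, v)) =
        (0, v) := by
      rw [← hg.unique (hΨd _ hU')]
      exact g.apply_symm_apply _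
    obtain ⟨s, v', hsv⟩ : ∃ s v', g.symm (0, v) = (s, v') := ⟨_, _, rfl⟩
    rw [hsv] at hgv
    obtain rfl : s = 0 := congrArg Prod.fst hgv
    have hv' : fderiv ℝ Y (x', η) (0, v') = v := congrArg Prod.snd hgv
    have h1 := hchain (0, v')
    rw [hv', hcontact x' η hU' hx, hv'] at h1
    exact h1.symm
  have hgrad' : gradient (fun z => f (x', z)) y = q (x', η) := by
    refine HasGradientAt.gradient (hasGradientAt_iff_hasFDerivAt.2 ?_)
    refine (hfd.comp y (hasFDerivAt_prodMk_right x' y)).congr_fderiv ?_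
    ext v
    simpa using hgradf v
  have hx1 := hchain (1, 0)
  obtain ⟨-, -, -, hYx, hχx, -⟩ := hsys _ (hball hU').1
  simp only [hYη] at hYx hχx
  rw [hYx, show ((1 : ℝ), -b (x', y, χ (x', η), q (x', η))) = ((1 : ℝ), (0 : E)) -
    (0, b (x', y, χ (x', η), q (x', η))) by simp, map_sub, hgradf] at hx1
  rw [hgrad', hfp]
  linear_combination hχx - x' * hx1

end Envelope

/-! ### Reduction to the reduced equation -/

section Reduction

variable {E : Type} [NormedAddCommGroup E] [InnerProductSpace ℝ E] [CompleteSpace E]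

lemma exists_smooth_gradient {f : E → ℝ} (hf : ContDiff ℝ ∞ f) :
    ∃ g : E → E, ContDiff ℝ ∞ g ∧ ∀ y, HasGradientAt f (g y) y := by
  obtain ⟨g, hg, hg'⟩ := exists_smooth_riesz (hf.fderiv_right (m := ∞) (by simp))
  refine ⟨g, hg, fun y => hasGradientAt_iff_hasFDerivAt.2 ?_⟩
  refine ((hf.differentiable (by simp)) y).hasFDerivAt.congr_fderiv ?_
  ext v
  simp [hg']

omit [CompleteSpace E] in
lemma fderiv_partial_w {F : ℝ × E × ℝ × E → ℝ} (hF : Differentiable ℝ F) (x : ℝ) (y : E) (w : ℝ)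
    (q : E) : HasDerivAt (fun w => F (x, y, w, q)) (fderiv ℝ F (x, y, w, q) (0, 0, 1, 0)) w :=
  (hF (x, y, w, q)).hasFDerivAt.comp_hasDerivAt w ((hasDerivAt_const w x).prodMk
    ((hasDerivAt_const w y).prodMk ((hasDerivAt_id w).prodMk (hasDerivAt_const w q))))

lemma hasGradientAt_partial_q {F : ℝ × E × ℝ × E → ℝ} (hF : Differentiable ℝ F) (x : ℝ) (y : E)
    (w : ℝ) (q g : E) (hg : ∀ v, fderiv ℝ F (x, y, w, q) (0, 0, 0, v) = inner ℝ g v) :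
    HasGradientAt (fun q => F (x, y, w, q)) g q := by
  refine hasGradientAt_iff_hasFDerivAt.2 (((hF (x, y, w, q)).hasFDerivAt.comp q
    ((hasFDerivAt_const x q).prodMk ((hasFDerivAt_const y q).prodMk
      ((hasFDerivAt_const w q).prodMk (hasFDerivAt_id q))))).congr_fderiv ?_)
  ext v
  simpa using hg v

/-- Local solvability of `x ∂ₓf = F (x, y, f, ∂_y f)`, `f (0, y) = ω₀ y`. Substituting
`f = ω₀ + x (ψ₀ + χ)`, where `ψ₀ = F_x / (1 - F_w)` is the only possible first-order coefficient,
turns the equation into `x χₓ = -(1 - F_w) χ + x G (x, y, χ, ∂_y χ)`. -/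
theorem exists_local_solution {F : ℝ × E × ℝ × E → ℝ} (hF : ContDiff ℝ ∞ F) {ω₀ : E → ℝ}
    (hω₀ : ContDiff ℝ ∞ ω₀) (hF_zero : ∀ y, F (0, y, ω₀ y, gradient ω₀ y) = 0)
    (hF_q : ∀ y, gradient (fun q => F (0, y, ω₀ y, q)) (gradient ω₀ y) = 0)
    (hF_w : ∀ y, deriv (fun w => F (0, y, w, gradient ω₀ y)) (ω₀ y) < 1) (y₀ : E) :
    ∃ (O : Set (ℝ × E)) (f : ℝ × E → ℝ), IsOpen O ∧ (0, y₀) ∈ O ∧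
      (∀ p ∈ O, ContDiffAt ℝ ∞ f p) ∧ (∀ y, f (0, y) = ω₀ y) ∧
      ∀ x y, (x, y) ∈ O → 0 ≤ x → x * fderiv ℝ f (x, y) (1, 0) =
        F (x, y, f (x, y), gradient (fun z => f (x, z)) y) := by
  have hFd := hF.differentiable (by simp)
  obtain ⟨g, hg, hg'⟩ := exists_smooth_gradient hω₀
  simp only [fun y => (hg' y).gradient] at hF_zero hF_q hF_w
  obtain ⟨gy, b, gw, -, -, hgw, hgrad⟩ := exists_partial_gradients hF
  let J : E → ℝ × E × ℝ × E := fun y => (0, y, ω₀ y, g y)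
  have hJ : ContDiff ℝ ∞ J := by fun_prop
  have hbJ : ∀ y, b (J y) = 0 := by
    intro y
    rw [← hF_q y]
    refine (hasGradientAt_partial_q hFd 0 y (ω₀ y) (g y) _ fun v => ?_).gradient.symm
    simpa using hgrad (J y) 0 0 v
  have hgwJ : ∀ y, gw (J y) < 1 := by
    intro y
    have h := hF_w y
    rw [(fderiv_partial_w hFd 0 y (ω₀ y) (g y)).deriv] at h
    have h1 := hgrad (J y) 0 1 0
    simp only [inner_zero_right, mul_one, zero_add, add_zero] at h1
    rwa [← h1]
  let c : E → ℝ := fun y => 1 - gw (J y)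
  have hc : ContDiff ℝ ∞ c := contDiff_const.sub (hgw.comp hJ)
  have hcpos : ∀ y, 0 < c y := fun y => sub_pos.2 (hgwJ y)
  let Fx : E → ℝ := fun y => fderiv ℝ F (J y) (1, 0, 0, 0)
  have hFx : ContDiff ℝ ∞ Fx :=
    ((hF.fderiv_right (m := ∞) (by simp)).comp hJ).clm_apply contDiff_const
  let ψ₀ : E → ℝ := fun y => Fx y / c y
  have hψ₀ : ContDiff ℝ ∞ ψ₀ := hFx.div hc fun y => (hcpos y).ne'
  have hψ₀c : ∀ y, Fx y = c y * ψ₀ y := fun y => by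
    have := (hcpos y).ne'
    simp only [ψ₀]
    field_simp
  obtain ⟨g₁, hg₁, hg₁'⟩ := exists_smooth_gradient hψ₀
  let κ : ℝ × E × ℝ × E → ℝ × E × ℝ × E := fun p =>
    (p.1, p.2.1, ω₀ p.2.1 + p.1 * (ψ₀ p.2.1 + p.2.2.1), g p.2.1 + p.1 • (g₁ p.2.1 + p.2.2.2))
  have hκ : ContDiff ℝ ∞ κ := by fun_prop
  obtain ⟨k, hk, hk1, hk2⟩ := exists_smooth_eq_mul (k := fun p => F (κ p)) (hF.comp hκ) (by
    rintro ⟨y, w, q⟩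
    simpa [κ] using hF_zero y)
  have hk0 : ∀ y w q, k (0, y, w, q) = ψ₀ y + gw (J y) * w := by
    intro y w q
    have h1 : HasDerivAt (fun s : ℝ => κ (s, y, w, q)) (1, 0, ψ₀ y + w, g₁ y + q) 0 := by
      refine (hasDerivAt_id (0:ℝ)).prodMk ((hasDerivAt_const (0:ℝ) y).prodMk
        (HasDerivAt.prodMk ?_ ?_))
      · simpa using ((hasDerivAt_id (0:ℝ)).mul_const (ψ₀ y + w)).const_add (ω₀ y)
      · simpa using ((hasDerivAt_id (0:ℝ)).smul_const (g₁ y + q)).const_add (g y)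
    have hκ0 : κ (0, y, w, q) = J y := by simp [κ, J]
    have h2 : HasDerivAt (fun s : ℝ => F (κ (s, y, w, q)))
        (fderiv ℝ F (J y) (1, 0, ψ₀ y + w, g₁ y + q)) 0 := by
      refine HasFDerivAt.comp_hasDerivAt (0:ℝ) ?_ h1
      rw [hκ0]
      exact (hFd _).hasFDerivAt
    have hFκ : HasFDerivAt (fun p => F (κ p)) (fderiv ℝ (fun p => F (κ p)) (0, y, w, q))
        (0, y, w, q) := ((hF.comp hκ).differentiable (by simp) (0, y, w, q)).hasFDerivAt
    have h3 : HasDerivAt (fun s : ℝ => F (κ (s, y, w, q)))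
        (fderiv ℝ (fun p => F (κ p)) (0, y, w, q) (1, 0)) 0 :=
      hFκ.comp_hasDerivAt (f := fun s : ℝ => (s, y, w, q)) (0:ℝ)
        ((hasDerivAt_id (0:ℝ)).prodMk (hasDerivAt_const (0:ℝ) (y, w, q)))
    rw [hk2, h3.unique h2, show ((1 : ℝ), (0 : E), ψ₀ y + w, g₁ y + q) =
      ((1 : ℝ), (0 : E), (0 : ℝ), (0 : E)) + (0, 0, ψ₀ y + w, g₁ y + q) by simp, map_add, hgrad,
      hbJ, inner_zero_left, inner_zero_right]
    change Fx y + _ = _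
    rw [hψ₀c]
    simp only [c]
    ring
  obtain ⟨G, hG, hG1, -⟩ := exists_smooth_eq_mul
    (k := fun p : ℝ × E × ℝ × E => k p - ψ₀ p.2.1 - gw (J p.2.1) * p.2.2.1)
    (by
      have h1 : ContDiff ℝ ∞ fun y => gw (J y) := hgw.comp hJ
      fun_prop)
    (by
      rintro ⟨y, w, q⟩
      simp [hk0])
  obtain ⟨O, χ, hO, h0, hχ, heq⟩ := exists_smooth_reduced_solution hc hG y₀ (hcpos y₀)
  refine ⟨O, fun p => ω₀ p.2 + p.1 * (ψ₀ p.2 + χ p), hO, h0, fun p hp => ?_, fun y => by simp,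
    fun x y hxy hx => ?_⟩
  · have := hχ p hp
    fun_prop
  · have hχp := hχ _ hxy
    have hχd := (hχp.differentiableAt (by simp)).hasFDerivAt
    have hgχ : HasGradientAt (fun z => χ (x, z)) (gradient (fun z => χ (x, z)) y) y :=
      (hχd.comp y (hasFDerivAt_prodMk_right x y)).differentiableAt.hasGradientAt
    have hgf : gradient (fun z => ω₀ z + x * (ψ₀ z + χ (x, z))) y =
        g y + x • (g₁ y + gradient (fun z => χ (x, z)) y) := by
      refine HasGradientAt.gradient (hasGradientAt_iff_hasFDerivAt.2 ?_)
      refine ((hg' y).hasFDerivAt.add (((hg₁' y).hasFDerivAt.add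
        hgχ.hasFDerivAt).const_mul x)).congr_fderiv ?_
      ext v
      simp
    have hfx : fderiv ℝ (fun p : ℝ × E => ω₀ p.2 + p.1 * (ψ₀ p.2 + χ p)) (x, y) (1, 0) =
        (ψ₀ y + χ (x, y)) + x * fderiv ℝ χ (x, y) (1, 0) := by
      have hsm : ContDiffAt ℝ ∞ (fun p : ℝ × E => ω₀ p.2 + p.1 * (ψ₀ p.2 + χ p)) (x, y) := by
        fun_prop
      refine (hasDerivAt_fst hsm).unique ?_
      have h := (((hasDerivAt_id x).mul ((hasDerivAt_const x (ψ₀ y)).add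
        (hasDerivAt_fst hχp))).const_add (ω₀ y))
      simpa using h
    rw [hfx, hgf]
    have h1 := hk1 x (y, χ (x, y), gradient (fun z => χ (x, z)) y)
    have h2 := hG1 x (y, χ (x, y), gradient (fun z => χ (x, z)) y)
    have h3 := heq x y hxy hx
    simp only [κ] at h1
    simp only [c] at h3
    rw [h1]
    linear_combination x * h3 - x * h2

end Reduction

/-! ### Maximum principle and behaviour at the boundary -/

section Uniqueness

variable {E : Type} [NormedAddCommGroup E] [InnerProductSpace ℝ E]

/-- The closed half-space `{(x, y) : 0 ≤ x}`. -/
def halfSpace (E : Type) : Set (ℝ × E) := {p | 0 ≤ p.1}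

/-- Maximum principle for a singular transport inequality `x vₓ - b · v_y ≤ s v`, required only
where `v > 0`, with `s < 1`, `|b| ≤ C x` and `v = O(x)`. The function `v / x ^ α` with `s < α < 1`
would otherwise have a positive maximum over the cone `|y - y₀| + C x ≤ r`; the speed bound on `b`
keeps the direction `(-x, b)` inside the cone, and the derivative there has the wrong sign. -/
theorem eventually_nonpos_of_transport_inequality [FiniteDimensional ℝ E] {v : ℝ × E → ℝ} {y₀ : E}
    {δ L C s : ℝ} (hδ : 0 < δ) (hC : 0 ≤ C) (hs : s < 1)
    (hcont : ContinuousOn v (halfSpace E ∩ Metric.ball (0, y₀) δ))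
    (hL : ∀ p ∈ halfSpace E ∩ Metric.ball (0, y₀) δ, |v p| ≤ L * p.1)
    (hsub : ∀ p ∈ halfSpace E ∩ Metric.ball (0, y₀) δ, 0 < p.1 → 0 < v p →
      DifferentiableAt ℝ v p ∧ ∃ b : E, ‖b‖ ≤ C * p.1 ∧ fderiv ℝ v p (p.1, -b) ≤ s * v p) :
    ∀ᶠ p in 𝓝[halfSpace E] (0, y₀), v p ≤ 0 := by
  obtain ⟨α, hα, hα1⟩ := exists_between (max_lt hs zero_lt_one)
  obtain ⟨hsα, hα0⟩ := max_lt_iff.1 hα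
  set D : Set (ℝ × E) := {p | 0 ≤ p.1 ∧ p.1 ≤ δ / 2 ∧ ‖p.2 - y₀‖ + C * p.1 ≤ δ / 2} with hD
  have hDN : D ⊆ halfSpace E ∩ Metric.ball (0, y₀) δ := by
    rintro p ⟨h1, h2, h3⟩
    refine ⟨h1, ?_⟩
    rw [Metric.mem_ball, Prod.dist_eq, max_lt_iff, Real.dist_eq, dist_eq_norm]
    have := mul_nonneg hC h1
    refine ⟨?_, by linarith⟩
    rw [sub_zero, abs_of_nonneg h1]
    linarith
  have hDclosed : IsClosed D := by
    have h1 : IsClosed {p : ℝ × E | 0 ≤ p.1} := isClosed_le (by fun_prop) (by fun_prop)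
    have h2 : IsClosed {p : ℝ × E | p.1 ≤ δ / 2} := isClosed_le (by fun_prop) (by fun_prop)
    have h3 : IsClosed {p : ℝ × E | ‖p.2 - y₀‖ + C * p.1 ≤ δ / 2} :=
      isClosed_le (by fun_prop) (by fun_prop)
    exact h1.inter (h2.inter h3)
  have hDcomp : IsCompact D := (isCompact_closedBall ((0 : ℝ), y₀) δ).of_isClosed_subset hDclosed
    fun p hp => Metric.ball_subset_closedBall (hDN hp).2
  have h0D : (0, y₀) ∈ D := ⟨le_rfl, by positivity, by simpa using by positivity⟩
  have hv0 : ∀ p ∈ D, p.1 = 0 → v p = 0 := by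
    intro p hp hp0
    have := hL p (hDN hp)
    rw [hp0, mul_zero] at this
    exact abs_nonpos_iff.1 this
  set ψ : ℝ × E → ℝ := fun p => v p / p.1 ^ α with hψ
  have hψ0 : ∀ p : ℝ × E, p.1 = 0 → ψ p = 0 := by
    intro p hp
    simp [hψ, hp, Real.zero_rpow hα0.ne']
  have hψcont : ContinuousOn ψ D := by
    intro p hp
    rcases hp.1.eq_or_lt with h0 | hpos
    · rw [ContinuousWithinAt, hψ0 p h0.symm]
      have hlim : Tendsto (fun p : ℝ × E => L * p.1 ^ (1 - α)) (𝓝[D] p) (𝓝 0) := by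
        have hc : Continuous fun p : ℝ × E => L * p.1 ^ (1 - α) :=
          continuous_const.mul ((Real.continuous_rpow_const (by linarith)).comp continuous_fst)
        have := hc.tendsto p
        rw [← h0, Real.zero_rpow (by linarith), mul_zero] at this
        exact this.mono_left nhdsWithin_le_nhds
      refine squeeze_zero_norm' ?_ hlim
      filter_upwards [self_mem_nhdsWithin] with p' hp'
      rcases hp'.1.eq_or_lt with h0' | hpos'
      · rw [hψ0 p' h0'.symm, ← h0', Real.zero_rpow (by linarith)]
        simp
      · have h1 := hL p' (hDN hp')
        rw [hψ, Real.norm_eq_abs, abs_div, abs_of_pos (Real.rpow_pos_of_pos hpos' α),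
          Real.rpow_sub hpos', Real.rpow_one, ← mul_div_assoc]
        gcongr
    · have h1 : ContinuousWithinAt v D p := (hcont p (hDN hp)).mono hDN
      have h2 : ContinuousAt (fun p : ℝ × E => p.1 ^ α) p :=
        continuousAt_fst.rpow_const (Or.inl hpos.ne')
      exact h1.div h2.continuousWithinAt (Real.rpow_pos_of_pos hpos α).ne'
  have hmain : ∀ p ∈ D, v p ≤ 0 := by
    by_contra! hcon
    obtain ⟨p₁, hp₁, hv₁⟩ := hcon
    have hp₁0 : 0 < p₁.1 := hp₁.1.lt_of_ne' fun h => hv₁.ne' (hv0 p₁ hp₁ h)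
    obtain ⟨p, hp, hmax⟩ := hDcomp.exists_isMaxOn ⟨_, h0D⟩ hψcont
    have hM : 0 < ψ p := (div_pos hv₁ (Real.rpow_pos_of_pos hp₁0 α)).trans_le (hmax hp₁)
    have hp0 : 0 < p.1 := hp.1.lt_of_ne' fun h => hM.ne' (hψ0 p h)
    have hxα := Real.rpow_pos_of_pos hp0 α
    have hvp : v p = ψ p * p.1 ^ α := by
      simp only [hψ]
      field_simp
    have hvpos : 0 < v p := hvp ▸ mul_pos hM hxα
    obtain ⟨hdiff, b, hb, hineq⟩ := hsub p (hDN hp) hp0 hvpos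
    set M := ψ p with hMdef
    have hmaxφ : IsMaxOn (fun p => v p - M * p.1 ^ α) D p := by
      intro p' hp'
      change v p' - M * p'.1 ^ α ≤ v p - M * p.1 ^ α
      rw [← hvp, sub_self, sub_nonpos]
      rcases hp'.1.eq_or_lt with h0 | hpos
      · rw [hv0 p' hp' h0.symm, ← h0, Real.zero_rpow hα0.ne', mul_zero]
      · exact (div_le_iff₀ (Real.rpow_pos_of_pos hpos α)).1 (hmax hp')
    have hcone : ((-p.1, b) : ℝ × E) ∈ posTangentConeAt D p := by
      refine mem_posTangentConeAt_of_segment_subset ?_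
      rw [segment_eq_image']
      rintro _ ⟨t, ht, rfl⟩
      simp only [add_sub_cancel_left]
      refine ⟨?_, ?_, ?_⟩
      · simp only [Prod.fst_add, Prod.smul_fst, smul_eq_mul]
        nlinarith [ht.2]
      · simp only [Prod.fst_add, Prod.smul_fst, smul_eq_mul]
        nlinarith [ht.1, hp.2.1]
      · simp only [Prod.fst_add, Prod.smul_fst, smul_eq_mul, Prod.snd_add, Prod.smul_snd]
        have h1 : ‖p.2 + t • b - y₀‖ ≤ ‖p.2 - y₀‖ + t * ‖b‖ := by
          rw [add_sub_right_comm]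
          refine (norm_add_le _ _).trans ?_
          rw [norm_smul, Real.norm_of_nonneg ht.1]
        have h2 := mul_le_mul_of_nonneg_left hb ht.1
        have h3 := hp.2.2
        linarith
    have hpow : HasFDerivAt (fun p : ℝ × E => M * p.1 ^ α)
        ((M * (α * p.1 ^ (α - 1))) • ContinuousLinearMap.fst ℝ ℝ E) p := by
      have h1 := ((Real.hasDerivAt_rpow_const (p := α) (Or.inl hp0.ne')).const_mul
        M).comp_hasFDerivAt p (hasFDerivAt_fst (𝕜 := ℝ) (p := p))
      exact h1
    have hle := (IsMaxOn.localize hmaxφ).hasFDerivWithinAt_nonpos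
      (hdiff.hasFDerivAt.sub hpow).hasFDerivWithinAt hcone
    have hneg : fderiv ℝ v p (-p.1, b) = -fderiv ℝ v p (p.1, -b) := by
      rw [← map_neg]
      simp
    have hx1 : p.1 ^ (α - 1) * p.1 = p.1 ^ α := by
      rw [Real.rpow_sub_one hp0.ne']
      field_simp
    have hle' : -fderiv ℝ v p (p.1, -b) + α * v p ≤ 0 := by
      rw [← hneg, hvp, ← hx1]
      simp only [sub_apply, smul_apply,
        ContinuousLinearMap.coe_fst', smul_eq_mul] at hle
      linarith
    nlinarith
  have hnear : ∀ᶠ p : ℝ × E in 𝓝 (0, y₀), p.1 < δ / 2 ∧ ‖p.2 - y₀‖ + C * p.1 < δ / 2 := by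
    have hc1 : ContinuousAt (fun p : ℝ × E => p.1) (0, y₀) := continuousAt_fst
    have hc2 : ContinuousAt (fun p : ℝ × E => ‖p.2 - y₀‖ + C * p.1) (0, y₀) := by fun_prop
    exact (hc1.eventually_lt_const (by simpa using hδ)).and
      (hc2.eventually_lt_const (by simpa using hδ))
  filter_upwards [self_mem_nhdsWithin, nhdsWithin_le_nhds hnear] with p hp1 hp2
  exact hmain p ⟨hp1, hp2.1.le, hp2.2.le⟩

lemma convex_halfSpace : Convex ℝ (halfSpace E) :=
  (convex_Ici (0:ℝ)).linear_preimage (LinearMap.fst ℝ ℝ E)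

omit [InnerProductSpace ℝ E] in
lemma halfSpace_mem_nhds {p : ℝ × E} (hp : 0 < p.1) : halfSpace E ∈ 𝓝 p :=
  (continuousAt_fst.eventually_const_lt hp).mono fun _ h => h.le

lemma uniqueDiffOn_halfSpace : UniqueDiffOn ℝ (halfSpace E) :=
  uniqueDiffOn_convex convex_halfSpace
    ⟨(1, 0), mem_interior_iff_mem_nhds.2 (halfSpace_mem_nhds one_pos)⟩

/-- A function that is smooth up to the boundary, together with its `y`-gradient, differs from its
boundary values by `O(x)`. -/
lemma exists_boundary_lipschitz [CompleteSpace E] {f : ℝ × E → ℝ} {ω₀ : E → ℝ} {O : Set (ℝ × E)}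
    (hO : IsOpen O) {y₀ : E} (h0 : (0, y₀) ∈ O) (hf : ContDiffOn ℝ ∞ f (O ∩ halfSpace E))
    (hf0 : ∀ y, (0, y) ∈ O → f (0, y) = ω₀ y) :
    ∃ L : ℝ, 0 ≤ L ∧ ∀ᶠ p in 𝓝[halfSpace E] (0, y₀), |f p - ω₀ p.2| ≤ L * p.1 ∧
      (0 < p.1 → ContDiffAt ℝ ∞ f p ∧
        ‖gradient (fun z => f (p.1, z)) p.2 - gradient ω₀ p.2‖ ≤ L * p.1) := by
  have h0H : ((0 : ℝ), y₀) ∈ halfSpace E := le_rfl (a := (0:ℝ))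
  have hin : ∀ p ∈ O ∩ halfSpace E, ContDiffWithinAt ℝ ∞ f (halfSpace E) p := by
    intro p hp
    refine (hf p hp).mono_of_mem_nhdsWithin ?_
    exact inter_mem (mem_nhdsWithin_of_mem_nhds (hO.mem_nhds hp.1)) self_mem_nhdsWithin
  have hc := hin _ ⟨h0, h0H⟩
  have hj : ContDiffWithinAt ℝ 1 (fderivWithin ℝ f (halfSpace E)) (halfSpace E) (0, y₀) :=
    hc.fderivWithin_right uniqueDiffOn_halfSpace
      (WithTop.coe_le_coe.2 le_top : ((1 + 1 : ℕ∞) : WithTop ℕ∞) ≤ ∞) h0H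
  obtain ⟨K₁, t₁, ht₁, hK₁⟩ := (hc.of_le (by simp)).exists_lipschitzOnWith convex_halfSpace
  obtain ⟨K₂, t₂, ht₂, hK₂⟩ := hj.exists_lipschitzOnWith convex_halfSpace
  obtain ⟨ε, hε, hball⟩ := Metric.mem_nhdsWithin_iff.1
    (inter_mem (inter_mem ht₁ ht₂) (mem_nhdsWithin_of_mem_nhds (hO.mem_nhds h0)))
  refine ⟨K₁ + K₂, by positivity, ?_⟩
  filter_upwards [inter_mem_nhdsWithin (halfSpace E) (Metric.ball_mem_nhds ((0 : ℝ), y₀) hε)]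
  rintro ⟨x, y⟩ ⟨hx, hxy⟩
  replace hx : 0 ≤ x := hx
  have hb0 : ((0 : ℝ), y) ∈ Metric.ball ((0 : ℝ), y₀) ε := by
    rw [Metric.mem_ball, Prod.dist_eq, max_lt_iff] at hxy ⊢
    exact ⟨by simpa using hε, hxy.2⟩
  obtain ⟨⟨hp1, hp2⟩, hpO⟩ := hball ⟨hxy, hx⟩
  obtain ⟨⟨hq1, hq2⟩, hqO⟩ := hball ⟨hb0, (le_rfl (a := (0:ℝ)) : (0, y) ∈ halfSpace E)⟩
  have hdist : dist (x, y) ((0 : ℝ), y) = x := by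
    rw [Prod.dist_eq, dist_self, Real.dist_eq, sub_zero, abs_of_nonneg hx, max_eq_left hx]
  have hK₁x := hK₁.dist_le_mul _ hp1 _ hq1
  have hK₂x := hK₂.dist_le_mul _ hp2 _ hq2
  rw [hdist, Real.dist_eq, hf0 y hqO] at hK₁x
  rw [hdist, dist_eq_norm] at hK₂x
  have hK₁0 : 0 ≤ (K₁ : ℝ) * x := by positivity
  have hK₂0 : 0 ≤ (K₂ : ℝ) * x := by positivity
  refine ⟨by simp only; linarith, fun hpos => ?_⟩
  replace hpos : 0 < x := hpos
  have hnhds := halfSpace_mem_nhds (E := E) (p := (x, y)) hpos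
  have hsm : ContDiffAt ℝ ∞ f (x, y) := (hin _ ⟨hpO, hx⟩).contDiffAt hnhds
  refine ⟨hsm, ?_⟩
  have hfd : HasFDerivAt f (fderivWithin ℝ f (halfSpace E) (x, y)) (x, y) := by
    rw [fderivWithin_of_mem_nhds hnhds]
    exact (hsm.differentiableAt (by simp)).hasFDerivAt
  have hg1 : HasFDerivAt (fun z => f (x, z)) _ y := hfd.comp y (hasFDerivAt_prodMk_right x y)
  have hω : HasFDerivAt ω₀ ((fderivWithin ℝ f (halfSpace E) (0, y)).comp
      (ContinuousLinearMap.inr ℝ ℝ E)) y := by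
    have h1 := ((hin _ ⟨hqO, (le_rfl (a := (0:ℝ)) : (0, y) ∈ halfSpace E)⟩).differentiableWithinAt
      (by simp)).hasFDerivWithinAt
    have h2 : HasFDerivAt (fun z => f (0, z)) _ y := h1.comp_hasFDerivAt y
      (hasFDerivAt_prodMk_right (𝕜 := ℝ) 0 y)
      (Eventually.of_forall fun z => (le_rfl (a := (0:ℝ)) : (0, z) ∈ halfSpace E))
    refine h2.congr_of_eventuallyEq ?_
    have hcz : ContinuousAt (fun z : E => ((0 : ℝ), z)) y := by fun_prop
    filter_upwards [hcz.eventually (hO.mem_nhds hqO)] with z hz using (hf0 z hz).symm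
  rw [hg1.hasGradientAt.gradient, hω.hasGradientAt.gradient, ← map_sub,
    LinearIsometryEquiv.norm_map, ← ContinuousLinearMap.sub_comp]
  refine (ContinuousLinearMap.opNorm_comp_le _ _).trans ?_
  refine (mul_le_of_le_one_right (norm_nonneg _) (ContinuousLinearMap.norm_inr_le_one ℝ ℝ E)).trans ?_
  simp only
  linarith

end Uniqueness

/-! ### Local uniqueness -/

section LocalUniqueness

variable {E : Type} [NormedAddCommGroup E] [InnerProductSpace ℝ E]

/-- Comparison of two solutions near a boundary point. By the mean value theorem their difference
satisfies the inequality of the maximum principle, with coefficients `F_w` and `b = F_q` taken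
between the two jets; `F_q = 0` at the boundary gives `|b| ≤ C x`. -/
theorem eventually_le_of_solutions [FiniteDimensional ℝ E] {F : ℝ × E × ℝ × E → ℝ}
    (hF : ContDiff ℝ ∞ F) {ω₀ : E → ℝ} (hω₀ : ContDiff ℝ ∞ ω₀)
    (hF_q : ∀ y, gradient (fun q => F (0, y, ω₀ y, q)) (gradient ω₀ y) = 0) {y₀ : E}
    (hF_w : deriv (fun w => F (0, y₀, w, gradient ω₀ y₀)) (ω₀ y₀) < 1)
    {O : Set (ℝ × E)} (hO : IsOpen O) (h0 : (0, y₀) ∈ O) {f g : ℝ × E → ℝ}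
    (hf : ContDiffOn ℝ ∞ f (O ∩ halfSpace E)) (hf0 : ∀ y, (0, y) ∈ O → f (0, y) = ω₀ y)
    (hfe : ∀ x y, (x, y) ∈ O → 0 < x → x * fderiv ℝ f (x, y) (1, 0) =
      F (x, y, f (x, y), gradient (fun z => f (x, z)) y))
    (hg : ContDiffOn ℝ ∞ g (O ∩ halfSpace E)) (hg0 : ∀ y, (0, y) ∈ O → g (0, y) = ω₀ y)
    (hge : ∀ x y, (x, y) ∈ O → 0 < x → x * fderiv ℝ g (x, y) (1, 0) =
      F (x, y, g (x, y), gradient (fun z => g (x, z)) y)) :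
    ∀ᶠ p in 𝓝[halfSpace E] (0, y₀), f p ≤ g p := by
  have hFd := hF.differentiable (by simp)
  obtain ⟨G, hG, hG'⟩ := exists_smooth_gradient hω₀
  simp only [fun y => (hG' y).gradient] at hF_q hF_w
  obtain ⟨gy, b, gw, -, hb, hgw, hgrad⟩ := exists_partial_gradients hF
  let J : E → ℝ × E × ℝ × E := fun y => (0, y, ω₀ y, G y)
  have hJ : Continuous J := by
    have h1 := hω₀.continuous
    have h2 := hG.continuous
    fun_prop
  have hbJ : ∀ y, b (J y) = 0 := by
    intro y
    rw [← hF_q y]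
    refine (hasGradientAt_partial_q hFd 0 y (ω₀ y) (G y) _ fun v => ?_).gradient.symm
    simpa using hgrad (J y) 0 0 v
  have hgwJ : gw (J y₀) < 1 := by
    have h := hF_w
    rw [(fderiv_partial_w hFd 0 y₀ (ω₀ y₀) (G y₀)).deriv] at h
    have h1 := hgrad (J y₀) 0 1 0
    simp only [inner_zero_right, mul_one, zero_add, add_zero] at h1
    rwa [← h1]
  obtain ⟨s, hs, hs1⟩ := exists_between hgwJ
  obtain ⟨K, t, ht, hK⟩ := (hb.contDiffAt (x := J y₀)).of_le (by simp) |>.exists_lipschitzOnWith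
  obtain ⟨ρ, hρ, hρball⟩ := Metric.mem_nhds_iff.1
    (inter_mem ht (hgw.continuous.continuousAt.eventually_lt_const hs))
  obtain ⟨L₁, hL₁, hfL⟩ := exists_boundary_lipschitz hO h0 hf hf0
  obtain ⟨L₂, hL₂, hgL⟩ := exists_boundary_lipschitz hO h0 hg hg0
  simp only [fun y => (hG' y).gradient] at hfL hgL
  set L : ℝ := 1 + L₁ + L₂ with hLdef
  have hsmall : ∀ᶠ p : ℝ × E in 𝓝 (0, y₀), L * p.1 + dist (J p.2) (J y₀) < ρ := by
    have hc : Continuous fun p : ℝ × E => L * p.1 + dist (J p.2) (J y₀) := by fun_prop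
    exact hc.continuousAt.eventually_lt_const (by simpa using hρ)
  have hsmallO : ∀ᶠ p : ℝ × E in 𝓝[halfSpace E] (0, y₀),
      L * p.1 + dist (J p.2) (J y₀) < ρ ∧ p ∈ O :=
    mem_nhdsWithin_of_mem_nhds (hsmall.and (hO.mem_nhds h0))
  obtain ⟨δ, hδ, hδball⟩ := Metric.mem_nhdsWithin_iff.1 ((hfL.and hgL).and hsmallO)
  rw [inter_comm] at hδball
  have hconcl := eventually_nonpos_of_transport_inequality (v := fun p => f p - g p) (y₀ := y₀)
    (δ := δ) (L := L₁ + L₂) (C := K * L) (s := s) hδ (by positivity) hs1 ?_ ?_ ?_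
  · filter_upwards [hconcl] with p hp using sub_nonpos.1 hp
  · have hsub : halfSpace E ∩ Metric.ball (0, y₀) δ ⊆ O ∩ halfSpace E :=
      fun p hp => ⟨(hδball hp).2.2, hp.1⟩
    exact (hf.continuousOn.mono hsub).sub (hg.continuousOn.mono hsub)
  · intro p hp
    obtain ⟨⟨⟨h1, -⟩, ⟨h2, -⟩⟩, -⟩ := hδball hp
    have h3 := abs_sub_le (f p) (ω₀ p.2) (g p)
    rw [abs_sub_comm (ω₀ p.2)] at h3
    linarith
  · rintro ⟨x, y⟩ hp hx hv
    obtain ⟨⟨⟨h1, h1'⟩, ⟨h2, h2'⟩⟩, hsm, hpO⟩ := hδball hp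
    obtain ⟨hfsm, hfg⟩ := h1' hx
    obtain ⟨hgsm, hgg⟩ := h2' hx
    simp only at hx hv hfg hgg h1 h2 hsm
    have hfd := (hfsm.differentiableAt (by simp)).hasFDerivAt
    have hgd := (hgsm.differentiableAt (by simp)).hasFDerivAt
    refine ⟨(hfd.sub hgd).differentiableAt, ?_⟩
    -- the `y`-gradients
    have hgradf : ∀ v : E, fderiv ℝ f (x, y) (0, v) =
        inner ℝ (gradient (fun z => f (x, z)) y) v := by
      intro v
      have h : HasFDerivAt (fun z => f (x, z)) _ y := hfd.comp y (hasFDerivAt_prodMk_right x y)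
      rw [h.hasGradientAt.gradient, InnerProductSpace.toDual_symm_apply]
      simp
    have hgradg : ∀ v : E, fderiv ℝ g (x, y) (0, v) =
        inner ℝ (gradient (fun z => g (x, z)) y) v := by
      intro v
      have h : HasFDerivAt (fun z => g (x, z)) _ y := hgd.comp y (hasFDerivAt_prodMk_right x y)
      rw [h.hasGradientAt.gradient, InnerProductSpace.toDual_symm_apply]
      simp
    have hfe' := hfe x y hpO hx
    have hge' := hge x y hpO hx
    set p₁ := gradient (fun z => f (x, z)) y
    set p₂ := gradient (fun z => g (x, z)) y
    have hLx0 : 0 ≤ L * x := by positivity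
    have hball : ∀ (w : ℝ) (q : E), |w - ω₀ y| ≤ L * x → ‖q - G y‖ ≤ L * x →
        (x, y, w, q) ∈ Metric.closedBall (J y) (L * x) := by
      intro w q hw hq
      have hLx : x ≤ L * x := le_mul_of_one_le_left hx.le (by linarith)
      simp only [Metric.mem_closedBall, J, Prod.dist_eq, dist_self, max_le_iff]
      refine ⟨?_, hLx0, by rwa [Real.dist_eq], by rwa [dist_eq_norm]⟩
      rwa [Real.dist_eq, sub_zero, abs_of_pos hx]
    have hL₁x : L₁ * x ≤ L * x := by gcongr; linarith
    have hL₂x : L₂ * x ≤ L * x := by gcongr; linarith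
    obtain ⟨ξ, hξ, hmvt⟩ := domain_mvt (f := F) (f' := fderiv ℝ F) (s := univ)
      (x := (x, y, g (x, y), p₂)) (y := (x, y, f (x, y), p₁))
      (fun z _ => (hFd z).hasFDerivAt.hasFDerivWithinAt) convex_univ (mem_univ _) (mem_univ _)
    have hξb : ξ ∈ Metric.closedBall (J y) (L * x) :=
      (convex_closedBall (J y) (L * x)).segment_subset
        (hball _ _ (h2.trans hL₂x) (hgg.trans hL₂x))
        (hball _ _ (h1.trans hL₁x) (hfg.trans hL₁x)) hξ
    have hξρ : ξ ∈ Metric.ball (J y₀) ρ := by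
      have := dist_triangle ξ (J y) (J y₀)
      have h5 := Metric.mem_closedBall.1 hξb
      exact Metric.mem_ball.2 (by linarith)
    have hJρ : J y ∈ Metric.ball (J y₀) ρ := Metric.mem_ball.2 (by linarith)
    obtain ⟨hξt, hξw⟩ := hρball hξρ
    replace hξw : gw ξ < s := hξw
    have hbξ : ‖b ξ‖ ≤ K * L * x := by
      have h5 := hK.dist_le_mul _ hξt _ (hρball hJρ).1
      rw [hbJ, dist_zero_right] at h5
      refine h5.trans ?_
      rw [mul_assoc]
      gcongr
      exact Metric.mem_closedBall.1 hξb
    refine ⟨b ξ, hbξ, ?_⟩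
    rw [show ((x, y, f (x, y), p₁) : ℝ × E × ℝ × E) - (x, y, g (x, y), p₂) =
      (0, 0, f (x, y) - g (x, y), p₁ - p₂) by simp, hgrad, ← hfe', ← hge', inner_zero_right,
      zero_add, inner_sub_right] at hmvt
    have hfgd : HasFDerivAt (fun p => f p - g p) _ (x, y) := hfd.sub hgd
    rw [hfgd.fderiv]
    simp only
    rw [show ((x, -b ξ) : ℝ × E) = x • ((1 : ℝ), (0 : E)) - (0, b ξ) by simp, map_sub, map_smul]
    simp only [sub_apply, smul_eq_mul, hgradf, hgradg]
    rw [real_inner_comm p₁ (b ξ), real_inner_comm p₂ (b ξ)] at hmvt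
    have := mul_le_mul_of_nonneg_right hξw.le hv.le
    linarith

lemma derivWithin_Ici_eq {f : ℝ × E → ℝ} {x : ℝ} {y : E} (hf : ContDiffAt ℝ ∞ f (x, y))
    (hx : 0 ≤ x) :
    derivWithin (fun s => f (s, y)) (Ici 0) x = fderiv ℝ f (x, y) (1, 0) :=
  (hasDerivAt_fst hf).hasDerivWithinAt.derivWithin (uniqueDiffOn_Ici 0 x hx)

/-- Two solutions agree near every boundary point. -/
theorem eventually_eq_of_solutions [FiniteDimensional ℝ E] {F : ℝ × E × ℝ × E → ℝ}
    (hF : ContDiff ℝ ∞ F) {ω₀ : E → ℝ} (hω₀ : ContDiff ℝ ∞ ω₀)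
    (hF_q : ∀ y, gradient (fun q => F (0, y, ω₀ y, q)) (gradient ω₀ y) = 0) {y₀ : E}
    (hF_w : deriv (fun w => F (0, y₀, w, gradient ω₀ y₀)) (ω₀ y₀) < 1)
    {O : Set (ℝ × E)} (hO : IsOpen O) (h0 : (0, y₀) ∈ O) {f g : ℝ × E → ℝ}
    (hf : ContDiffOn ℝ ∞ f (O ∩ halfSpace E)) (hf0 : ∀ y, (0, y) ∈ O → f (0, y) = ω₀ y)
    (hfe : ∀ x y, (x, y) ∈ O → 0 ≤ x → x * derivWithin (fun s => f (s, y)) (Ici 0) x =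
      F (x, y, f (x, y), gradient (fun z => f (x, z)) y))
    (hg : ContDiffOn ℝ ∞ g (O ∩ halfSpace E)) (hg0 : ∀ y, (0, y) ∈ O → g (0, y) = ω₀ y)
    (hge : ∀ x y, (x, y) ∈ O → 0 ≤ x → x * derivWithin (fun s => g (s, y)) (Ici 0) x =
      F (x, y, g (x, y), gradient (fun z => g (x, z)) y)) :
    ∀ᶠ p in 𝓝[halfSpace E] (0, y₀), f p = g p := by
  have key : ∀ h : ℝ × E → ℝ, ContDiffOn ℝ ∞ h (O ∩ halfSpace E) →
      (∀ x y, (x, y) ∈ O → 0 ≤ x → x * derivWithin (fun s => h (s, y)) (Ici 0) x =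
        F (x, y, h (x, y), gradient (fun z => h (x, z)) y)) →
      ∀ x y, (x, y) ∈ O → 0 < x → x * fderiv ℝ h (x, y) (1, 0) =
        F (x, y, h (x, y), gradient (fun z => h (x, z)) y) := by
    intro h hsm he x y hxy hx
    have hat : ContDiffAt ℝ ∞ h (x, y) := (hsm _ ⟨hxy, hx.le⟩).contDiffAt
      (inter_mem (hO.mem_nhds hxy) (halfSpace_mem_nhds hx))
    rw [← he x y hxy hx.le, derivWithin_Ici_eq hat hx.le]
  filter_upwards [eventually_le_of_solutions hF hω₀ hF_q hF_w hO h0 hf hf0 (key f hf hfe) hg hg0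
      (key g hg hge),
    eventually_le_of_solutions hF hω₀ hF_q hF_w hO h0 hg hg0 (key g hg hge) hf hf0
      (key f hf hfe)] with p h1 h2 using le_antisymm h1 h2

end LocalUniqueness

/-! ### Gluing local solutions -/

section Gluing

/-- Local functions `f i` near the boundary points, which agree near every common boundary
point, are glued along a locally finite cover of the boundary: near each boundary point, the glued
function is one of the `f i`. -/
theorem exists_glued_function {E : Type} [NormedAddCommGroup E] {O : E → Set (ℝ × E)}
    {f : E → ℝ × E → ℝ} (hO : ∀ i, IsOpen (O i)) (h0 : ∀ i, ((0 : ℝ), i) ∈ O i)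
    (hagree : ∀ i j y, (0, y) ∈ O i → (0, y) ∈ O j →
      ∀ᶠ p in 𝓝[halfSpace E] (0, y), f i p = f j p) :
    ∃ g : ℝ × E → ℝ, (∀ y, ∃ i, g (0, y) = f i (0, y)) ∧
      ∀ y, ∃ i, (0, y) ∈ O i ∧ ∀ᶠ p in 𝓝[halfSpace E] (0, y), g p = f i p := by
  have hball : ∀ i, ∃ r > 0, ∀ y ∈ Metric.ball i r, ((0 : ℝ), y) ∈ O i := by
    intro i
    have hc : ContinuousAt (fun y : E => ((0 : ℝ), y)) i := by fun_prop
    exact Metric.eventually_nhds_iff_ball.1 (hc.eventually ((hO i).mem_nhds (h0 i)))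
  choose r hr hrO using hball
  obtain ⟨v, hv, hvcover, hvfin, hvsub⟩ := precise_refinement (fun i => Metric.ball i (r i / 2))
    (fun i => Metric.isOpen_ball)
    (iUnion_eq_univ_iff.2 fun i => ⟨i, Metric.mem_ball_self (half_pos (hr i))⟩)
  have hvcl : ∀ i y, y ∈ closure (v i) → ((0 : ℝ), y) ∈ O i := by
    intro i y hy
    refine hrO i y ?_
    have h1 := (closure_mono (hvsub i)).trans Metric.closure_ball_subset_closedBall hy
    exact Metric.closedBall_subset_ball (half_lt_self (hr i)) h1
  choose idx hidx using fun y => iUnion_eq_univ_iff.1 hvcover y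
  refine ⟨fun p => f (idx p.2) p, fun y => ⟨idx y, rfl⟩, fun y => ⟨idx y,
    hvcl _ _ (subset_closure (hidx y)), ?_⟩⟩
  obtain ⟨t, ht, hfin⟩ := hvfin y
  have hall : ∀ᶠ p in 𝓝[halfSpace E] (0, y), ∀ j ∈ {j | (v j ∩ t).Nonempty},
      p.2 ∈ v j → f j p = f (idx y) p := by
    rw [eventually_all_finite hfin]
    intro j _
    by_cases hj : y ∈ closure (v j)
    · filter_upwards [hagree j (idx y) y (hvcl j y hj) (hvcl _ _ (subset_closure (hidx y)))]
        with p hp _ using hp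
    · have hsnd : ContinuousAt (fun p : ℝ × E => p.2) (0, y) := continuousAt_snd
      filter_upwards [mem_nhdsWithin_of_mem_nhds
        (hsnd.eventually (isClosed_closure.isOpen_compl.mem_nhds hj))] with p hp hpv
      exact absurd (subset_closure hpv) hp
  have hsnd : ContinuousAt (fun p : ℝ × E => p.2) (0, y) := continuousAt_snd
  filter_upwards [hall, mem_nhdsWithin_of_mem_nhds (hsnd.eventually ht)] with p hp hpt
  exact hp (idx p.2) ⟨p.2, hidx p.2, hpt⟩ (hidx p.2)

end Gluing

end FuchsianPDE

/-! ### Existence and uniqueness -/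

open FuchsianPDE Set Filter Topology

theorem mainTheorem2 (m : ℕ)
    (F : ℝ × EuclideanSpace ℝ (Fin m) × ℝ × EuclideanSpace ℝ (Fin m) → ℝ)
    (hF : ContDiff ℝ ((⊤ : ℕ∞) : WithTop ℕ∞) F)
    (ω₀ : EuclideanSpace ℝ (Fin m) → ℝ) (hω₀ : ContDiff ℝ ((⊤ : ℕ∞) : WithTop ℕ∞) ω₀)
    (hF_zero : ∀ y, F (0, y, ω₀ y, gradient ω₀ y) = 0)
    (hF_q : ∀ y, gradient (fun q => F (0, y, ω₀ y, q)) (gradient ω₀ y) = 0)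
    (hF_ω : ∀ y, deriv (fun w => F (0, y, w, gradient ω₀ y)) (ω₀ y) < 1) :
    (∃ (U : Set (ℝ × EuclideanSpace ℝ (Fin m))) (ω : ℝ × EuclideanSpace ℝ (Fin m) → ℝ),
      IsBoundaryNhd U ∧ IsSmoothSolutionOn F ω₀ U ω) ∧
    (∀ (U₁ U₂ : Set (ℝ × EuclideanSpace ℝ (Fin m)))
      (ω₁ ω₂ : ℝ × EuclideanSpace ℝ (Fin m) → ℝ),
      IsBoundaryNhd U₁ → IsBoundaryNhd U₂ →
      IsSmoothSolutionOn F ω₀ U₁ ω₁ → IsSmoothSolutionOn F ω₀ U₂ ω₂ →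
      ∃ V : Set (ℝ × EuclideanSpace ℝ (Fin m)),
        IsBoundaryNhd V ∧ V ⊆ U₁ ∩ U₂ ∧ Set.EqOn ω₁ ω₂ V) := by
  refine ⟨?_, ?_⟩
  · choose O f hO h0 hsm hinit heq using
      exists_local_solution hF hω₀ hF_zero hF_q hF_ω
    have hder : ∀ i x y, (x, y) ∈ O i → 0 ≤ x →
        x * derivWithin (fun s => f i (s, y)) (Ici 0) x =
          F (x, y, f i (x, y), gradient (fun z => f i (x, z)) y) := by
      intro i x y hxy hx
      rw [derivWithin_Ici_eq (hsm i _ hxy) hx, heq i x y hxy hx]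
    obtain ⟨ω, hω0, hω⟩ := exists_glued_function hO h0 (f := f) (by
      intro i j y hi hj
      exact eventually_eq_of_solutions hF hω₀ hF_q (hF_ω y) ((hO i).inter (hO j)) ⟨hi, hj⟩
        (fun p hp => (hsm i p hp.1.1).contDiffWithinAt) (fun z _ => hinit i z)
        (fun x z hz hx => hder i x z hz.1 hx)
        (fun p hp => (hsm j p hp.1.2).contDiffWithinAt) (fun z _ => hinit j z)
        (fun x z hz hx => hder j x z hz.2 hx))
    -- the set where the glued function locally coincides with one of the local solutions
    let A : Set (ℝ × EuclideanSpace ℝ (Fin m)) :=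
      {p | ∃ i, p ∈ O i ∧ ∀ᶠ p' in 𝓝 p, p' ∈ halfSpace _ → ω p' = f i p'}
    have hA : IsOpen A := by
      refine isOpen_iff_eventually.2 fun p ⟨i, hi, hp⟩ => ?_
      filter_upwards [(hO i).mem_nhds hi, eventually_eventually_nhds.2 hp] with p' h1 h2
        using ⟨i, h1, h2⟩
    refine ⟨A ∩ halfSpace _, ω, ⟨⟨A, hA, rfl⟩, fun y => ⟨?_, le_rfl (a := (0 : ℝ))⟩⟩, ?_, ?_, ?_⟩
    · obtain ⟨i, hi, hy⟩ := hω y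
      exact ⟨i, hi, eventually_nhdsWithin_iff.1 hy⟩
    · rintro p ⟨⟨i, hi, hp⟩, hpH⟩
      refine ((hsm i p hi).contDiffWithinAt.congr_of_eventuallyEq (s := halfSpace _)
        (eventually_nhdsWithin_iff.2 hp) (hp.self_of_nhds hpH)).mono inter_subset_right
    · intro y
      obtain ⟨i, hi⟩ := hω0 y
      rw [hi, hinit]
    · rintro x y ⟨⟨i, hi, hp⟩, hpH⟩
      have hωp : ω (x, y) = f i (x, y) := hp.self_of_nhds hpH
      have hx1 : (fun s => ω (s, y)) =ᶠ[𝓝[Ici 0] x] fun s => f i (s, y) := by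
        have hc : ContinuousAt (fun s : ℝ => (s, y)) x := by fun_prop
        exact eventually_nhdsWithin_iff.2 (hc.eventually hp)
      have hy1 : (fun z => ω (x, z)) =ᶠ[𝓝 y] fun z => f i (x, z) := by
        have hc : ContinuousAt (fun z : EuclideanSpace ℝ (Fin m) => (x, z)) y := by fun_prop
        filter_upwards [hc.eventually hp] with z hz using hz hpH
      have hgrad : gradient (fun z => ω (x, z)) y = gradient (fun z => f i (x, z)) y := by
        simp only [gradient, hy1.fderiv_eq]
      rw [hx1.derivWithin_eq hωp, hgrad, hωp]
      exact hder i x y hi hpH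
  · rintro U₁ U₂ ω₁ ω₂ ⟨⟨O₁, hO₁, rfl⟩, hU₁⟩ ⟨⟨O₂, hO₂, rfl⟩, hU₂⟩ hω₁ hω₂
    let A : Set (ℝ × EuclideanSpace ℝ (Fin m)) :=
      {p | ∀ᶠ p' in 𝓝 p, p' ∈ halfSpace _ → ω₁ p' = ω₂ p'}
    have hA : IsOpen A := isOpen_iff_eventually.2 fun p hp => eventually_eventually_nhds.2 hp
    refine ⟨(O₁ ∩ O₂ ∩ A) ∩ halfSpace _, ⟨⟨_, (hO₁.inter hO₂).inter hA, rfl⟩, fun y => ?_⟩,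
      fun p hp => ⟨⟨hp.1.1.1, hp.2⟩, ⟨hp.1.1.2, hp.2⟩⟩, fun p hp => hp.1.2.self_of_nhds hp.2⟩
    refine ⟨⟨⟨(hU₁ y).1, (hU₂ y).1⟩, ?_⟩, le_rfl (a := (0 : ℝ))⟩
    exact eventually_nhdsWithin_iff.1 (eventually_eq_of_solutions hF hω₀ hF_q (hF_ω y)
      (hO₁.inter hO₂) ⟨(hU₁ y).1, (hU₂ y).1⟩
      (hω₁.smooth.mono fun p hp => ⟨hp.1.1, hp.2⟩) (fun z _ => hω₁.initial z)
      (fun x z hz hx => hω₁.eqn x z ⟨hz.1, hx⟩)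
      (hω₂.smooth.mono fun p hp => ⟨hp.1.2, hp.2⟩) (fun z _ => hω₂.initial z)
      (fun x z hz hx => hω₂.eqn x z ⟨hz.2, hx⟩))
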